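/- Let $n\ge 1$, let $\Omega\subset\mathbb{R}^n$ be a bounded open set, and let $u_0\in H_0^1(\Omega)$, $u_1\in L^2(\Omega)$. Write $(\cdot,\cdot)$ and $\|\cdot\|$ for the inner product and norm of $L^2(\Omega)$. Consider the problem $$u_{tt}-\Delta u=f(x,u)\ \ (t>0,\ x\in\Omega),\qquad u(0,\cdot)=u_0,\quad u_t(0,\cdot)=u_1,\qquad u=0\ \text{ on }\partial\Omega, \tag{P}$$ where $f$ has one of the forms $$(F1)\quad f(x,u)=\sum_{i=1}^r a_i(x)|u|^{p_i-1}u+\sum_{j=1}^s b_j(x)|u|^{q_j-1}u,$$ $$(F2)\quad f(x,u)=a_1(x)|u|^{p_1}+\sum_{i=2}^r a_i(x)|u|^{p_i-1}u+\sum_{j=1}^s b_j(x)|u|^{q_j-1}u,$$ with $r\ge1$, $s\ge0$, $1<q_1<\dots<q_s<p_1<\dots<p_r$, with $p_r<\frac{n+2}{n-2}$ if $n\ge 3$, with $a_i,b_j\in C(\overline\Omega)$, $a_i\ge 0$ for $i\ge 2$, $b_j\le 0$ on $\overline\Omega$, and with $a_1$ taking both positive and negative values in $\Omega$. Put $$E(u,v)=\tfrac12\big(\|v\|^2+\|\nabla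 u\|^2\big)-\int_\Omega\int_0^{u(x)}f(x,w)\,dw\,dx,\qquad I(z)=\|\nabla z\|^2-\int_\Omega z f(x,z)\,dx,$$ $E(0)=E(u_0,u_1)$, and $\mathcal C=C_2^{-2}$, where $C_2>0$ is a constant with $\|z\|\le C_2\|\nabla z\|$ for all $z\in H_0^1(\Omega)$. Suppose that $(u_0,u_1)$ satisfies at least one of the following conditions: 1. (Straughan) $E(0)<\dfrac12\dfrac{(u_0,u_1)^2}{\|u_0\|^2}$ and $(u_0,u_1)>0$; 2. (Gazzola–Squassina) $E(0)<\dfrac{\mathcal C(p_1-1)}{2(p_1+1)}\|u_0\|^2$, $(u_0,u_1)\ge0$ and $I(u_0)<0$; 3. (Xu) $E(0)<\dfrac{\mathcal C(p_1-1)}{(1+\mathcal C)(p_1+1)}(u_0,u_1)$, $(u_0,u_1)>0$ and $I(u_0)<0$. Then: (a) if $E(0)>0$, the data also satisfy $$\|u_0\|\ne0,\qquad (u_0,u_1)\ge0,\qquad 0<E(0)<\frac{\mathcal C(p_1-1)}{2(p_1+1)}\|u_0\|^2+\frac12\frac{(u_0,u_1)^2}{\|u_0\|^2};$$ (b) problem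 (P) has no global in time weak solution. Here a global weak solution is a function $u\in C([0,\infty);H_0^1(\Omega))\cap C^1([0,\infty);L^2(\Omega))\cap C^2((0,\infty);H^{-1}(\Omega))$ with $u(0)=u_0$, $u_t(0)=u_1$ such that $$(u_t(t),\eta)+\int_0^t(\nabla u(\tau),\nabla\eta)\,d\tau=\int_0^t\int_\Omega f(x,u)\,\eta\,dx\,d\tau+(u_1,\eta)\qquad\text{for all }\eta\in H_0^1(\Omega),\ t\ge0;$$ when $n\ge3$ and $p_r\ge\frac{n}{n-2}$ (but not otherwise) it is moreover understood to satisfy the energy inequality $E(u(t),u_t(t))\le E(0)$ for all $t\ge0$ (in particular, every solution that conserves the energy is covered). -/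

import Mathlib

open MeasureTheory Set

noncomputable section

namespace WaveBlowUp

/-- The Euclidean space `ℝⁿ`. -/
abbrev E (n : ℕ) := EuclideanSpace ℝ (Fin n)

/-- The space `L²(Ω)` of real functions. -/
abbrev L2 {n : ℕ} (Ω : Set (E n)) := Lp ℝ 2 (volume.restrict Ω)

/-- The space `L²(Ω; ℝⁿ)` of vector fields. -/
abbrev L2Vec {n : ℕ} (Ω : Set (E n)) := Lp (E n) 2 (volume.restrict Ω)

/-- Test functions: `φ ∈ C_c^∞(Ω)`. -/
def IsTest {n : ℕ} (Ω : Set (E n)) (φ : E n → ℝ) : Prop :=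
  ContDiff ℝ (⊤ : ℕ∞) φ ∧ HasCompactSupport φ ∧ tsupport φ ⊆ Ω

/-- `H₀¹(Ω)`: the closure of `C_c^∞(Ω)` in the norm `(‖z‖² + ‖∇z‖²)^{1/2}`. An element is stored
as the pair `(z, ∇z)` of an `L²` function and its weak gradient. -/
def H01 {n : ℕ} (Ω : Set (E n)) : Submodule ℝ (WithLp 2 (L2 Ω × L2Vec Ω)) :=
  (Submodule.span ℝ {w : WithLp 2 (L2 Ω × L2Vec Ω) | ∃ φ : E n → ℝ, IsTest Ω φ ∧
    w.fst =ᵐ[volume.restrict Ω] φ ∧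
    w.snd =ᵐ[volume.restrict Ω] fun x => gradient φ x}).topologicalClosure

variable {n : ℕ} {Ω : Set (E n)}

/-- The inclusion `H₀¹(Ω) → L²(Ω)`. -/
def val : H01 Ω →L[ℝ] L2 Ω :=
  (WithLp.fstL 2 ℝ (L2 Ω) (L2Vec Ω)).comp (H01 Ω).subtypeL

/-- The weak gradient `H₀¹(Ω) → L²(Ω; ℝⁿ)`. -/
def grad : H01 Ω →L[ℝ] L2Vec Ω :=
  (WithLp.sndL 2 ℝ (L2 Ω) (L2Vec Ω)).comp (H01 Ω).subtypeL

/-- The embedding `L²(Ω) → H⁻¹(Ω) = (H₀¹(Ω))*`, `g ↦ (η ↦ ∫_Ω g η)`. -/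
def toHneg (g : L2 Ω) : StrongDual ℝ (H01 Ω) := (innerSL ℝ g).comp val

/-- The two forms of the nonlinearity, which differ in the term with coefficient `a₁`. -/
inductive Form
  | F1
  | F2

/-- The data of the nonlinearity. The coefficients `a₁, a₂, …` are written `a 0, a 1, …`, and
likewise for the exponents; there is at least one `a` and possibly no `b`. -/
structure Nonlinearity (n : ℕ) where
  form : Form
  r : ℕ
  s : ℕ
  p : Fin (r + 1) → ℝ
  q : Fin s → ℝ
  a : Fin (r + 1) → E n → ℝ
  b : Fin s → E n → ℝ

/-- The function `f(x,u)`. -/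
def Nonlinearity.f (N : Nonlinearity n) (x : E n) (u : ℝ) : ℝ :=
  (match N.form with
    | Form.F1 => N.a 0 x * (|u| ^ (N.p 0 - 1) * u)
    | Form.F2 => N.a 0 x * |u| ^ (N.p 0))
  + ∑ i : Fin N.r, N.a i.succ x * (|u| ^ (N.p i.succ - 1) * u)
  + ∑ j : Fin N.s, N.b j x * (|u| ^ (N.q j - 1) * u)

/-- The assumptions on exponents and coefficients. -/
structure Nonlinearity.Admissible (N : Nonlinearity n) (Ω : Set (E n)) : Prop where
  one_lt_p : 1 < N.p 0
  p_strictMono : StrictMono N.p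
  one_lt_q : ∀ j, 1 < N.q j
  q_strictMono : StrictMono N.q
  q_lt_p : ∀ j, N.q j < N.p 0
  p_subcritical : 3 ≤ n → N.p (Fin.last N.r) < ((n : ℝ) + 2) / ((n : ℝ) - 2)
  a_continuous : ∀ i, ContinuousOn (N.a i) (closure Ω)
  b_continuous : ∀ j, ContinuousOn (N.b j) (closure Ω)
  a_nonneg : ∀ i, i ≠ 0 → ∀ x ∈ closure Ω, 0 ≤ N.a i x
  b_nonpos : ∀ j, ∀ x ∈ closure Ω, N.b j x ≤ 0
  a_pos : ∃ x ∈ Ω, 0 < N.a 0 x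
  a_neg : ∃ x ∈ Ω, N.a 0 x < 0

/-- The energy `E(u,v) = (‖v‖² + ‖∇u‖²)/2 - ∫_Ω ∫_0^{u(x)} f(x,w) dw dx`. -/
def energy (N : Nonlinearity n) (u : H01 Ω) (v : L2 Ω) : ℝ :=
  (1 / 2) * (‖v‖ ^ 2 + ‖grad u‖ ^ 2) - ∫ x in Ω, ∫ w in (0 : ℝ)..(val u x), N.f x w

/-- The Nehari functional `I(z) = ‖∇z‖² - ∫_Ω z f(x,z) dx`. -/
def nehari (N : Nonlinearity n) (z : H01 Ω) : ℝ :=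
  ‖grad z‖ ^ 2 - ∫ x in Ω, val z x * N.f x (val z x)

/-- The condition of Straughan. -/
def CondStraughan (N : Nonlinearity n) (u₀ : H01 Ω) (u₁ : L2 Ω) : Prop :=
  energy N u₀ u₁ < (1 / 2) * (inner ℝ (val u₀) u₁ ^ 2 / ‖val u₀‖ ^ 2) ∧
    0 < inner ℝ (val u₀) u₁

/-- The condition of Gazzola and Squassina, with Poincaré constant `C`. -/
def CondGazzolaSquassina (C : ℝ) (N : Nonlinearity n) (u₀ : H01 Ω) (u₁ : L2 Ω) : Prop :=
  energy N u₀ u₁ < C * (N.p 0 - 1) / (2 * (N.p 0 + 1)) * ‖val u₀‖ ^ 2 ∧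
    0 ≤ inner ℝ (val u₀) u₁ ∧ nehari N u₀ < 0

/-- The condition of Xu, with Poincaré constant `C`. -/
def CondXu (C : ℝ) (N : Nonlinearity n) (u₀ : H01 Ω) (u₁ : L2 Ω) : Prop :=
  energy N u₀ u₁ < C * (N.p 0 - 1) / ((1 + C) * (N.p 0 + 1)) * inner ℝ (val u₀) u₁ ∧
    0 < inner ℝ (val u₀) u₁ ∧ nehari N u₀ < 0

/-- The new sufficient condition for nonexistence, with Poincaré constant `C`. -/
def CondNew (C : ℝ) (N : Nonlinearity n) (u₀ : H01 Ω) (u₁ : L2 Ω) : Prop :=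
  ‖val u₀‖ ≠ 0 ∧ 0 ≤ inner ℝ (val u₀) u₁ ∧ 0 < energy N u₀ u₁ ∧
    energy N u₀ u₁ < C * (N.p 0 - 1) / (2 * (N.p 0 + 1)) * ‖val u₀‖ ^ 2
      + (1 / 2) * (inner ℝ (val u₀) u₁ ^ 2 / ‖val u₀‖ ^ 2)

/-- `u` is a weak solution on `[0,∞) × Ω`, with time derivative `v = u_t`, of
`u_tt - Δu = f(x,u)`, `u = 0` on the boundary, `u(0) = u₀`, `u_t(0) = u₁`. -/
structure IsGlobalWeakSolution (N : Nonlinearity n) (u₀ : H01 Ω) (u₁ : L2 Ω)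
    (u : ℝ → H01 Ω) (v : ℝ → L2 Ω) : Prop where
  continuousOn : ContinuousOn u (Ici 0)
  hasDeriv : ∀ t ∈ Ici (0 : ℝ), HasDerivWithinAt (fun τ => val (u τ)) (v t) (Ici 0) t
  continuousOn_deriv : ContinuousOn v (Ici 0)
  contDiffOn_two : ContDiffOn ℝ 2 (fun t => toHneg (val (u t))) (Ioi 0)
  initial : u 0 = u₀
  initial_deriv : v 0 = u₁
  weak : ∀ η : H01 Ω, ∀ t ∈ Ici (0 : ℝ),
    inner ℝ (v t) (val η) + ∫ τ in (0 : ℝ)..t, inner ℝ (grad (u τ)) (grad η)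
      = (∫ τ in (0 : ℝ)..t, ∫ x in Ω, N.f x (val (u τ) x) * val η x) + inner ℝ u₁ (val η)

end WaveBlowUp

end

noncomputable section

namespace WaveBlowUp

open Filter Topology
open scoped ENNReal NNReal

/-! The proof is a concavity argument for `ψ = ‖u‖²`. Testing the equation with `u` gives `ψ'' =
2(‖u_t‖² - ‖∇u‖² + ∫ u f(x,u))`. The sign and order assumptions on the terms of `f` give `(p₁+1)∫F ≤
∫ u f`, where `F` is the primitive of `f`. With `E(u,u_t) ≤ E(0)`, Poincaré and Cauchy–Schwarz this
becomes `ψψ'' ≥ (δ+1)/2 ψ'² + αψ² - βψ`, where `δ = (p₁+1)/2 > 1`, `α = (p₁-1)𝒞` and `β =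
2(p₁+1)E(0)`.

Put `G = αψ + (δ/2)ψ'²/ψ - β`. While `ψ' ≥ 0`, the product `Gψ^(-δ)` is nondecreasing, hence so is
`G`, and `ψ'' ≥ G`. If `G(0) > 0` and `ψ'(0) ≥ 0`, then `ψ'` can never become negative and `ψ` grows
at least quadratically. Once `αψ ≥ β`, a negative power of `ψ` is concave and strictly decreasing,
so it cannot stay positive for all time (`false_of_differential_inequality`). The condition `G(0) >
0` is the upper bound on `E(0)` in (a), multiplied by `2(p₁+1)`. Each of the three conditions
implies that bound, whatever the sign of `E(0)` (`initial_data_bound`).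

The regularity is supplied by `hasDerivWithinAt_inner_velocity`, which computes `ψ''`, and by the
Sobolev and Hölder bounds in `exists_dual_bound`. Where the energy inequality is not assumed,
`f(·,u)` lies in `L²` and the energy is conserved (`energy_eq_of_subcritical`). -/

/-! ### The differential inequality and its blow-up. -/

lemma le_of_hasDerivWithinAt_nonneg {f f' : ℝ → ℝ} {a b : ℝ} (ha : 0 ≤ a) (hab : a ≤ b)
    (hf : ∀ t ∈ Icc a b, HasDerivWithinAt f (f' t) (Ici 0) t)
    (hf' : ∀ t ∈ Icc a b, 0 ≤ f' t) : f a ≤ f b := by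
  have hsub : Icc a b ⊆ Ici 0 := fun t ht => ha.trans ht.1
  refine monotoneOn_of_hasDerivWithinAt_nonneg (f' := f') (convex_Icc a b)
    (fun t ht => ((hf t ht).continuousWithinAt).mono hsub) ?_ ?_
    (left_mem_Icc.2 hab) (right_mem_Icc.2 hab) hab
  · intro t ht
    exact (hf t (interior_subset ht)).mono (interior_subset.trans hsub)
  · intro t ht
    exact hf' t (interior_subset ht)

/-- The quantity which stays positive as long as `ψ' ≥ 0`. -/
lemma blowup_functional_pos {ψ ψ₁ ψ₂ : ℝ → ℝ} {δ α β T : ℝ} (hδ : 1 < δ) (hα : 0 < α)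
    (hT : 0 ≤ T)
    (h₀ : ∀ t ∈ Ici (0 : ℝ), HasDerivWithinAt ψ (ψ₁ t) (Ici 0) t)
    (h₁ : ∀ t ∈ Ici (0 : ℝ), HasDerivWithinAt ψ₁ (ψ₂ t) (Ici 0) t)
    (hineq : ∀ t ∈ Ici (0 : ℝ),
      (δ + 1) / 2 * ψ₁ t ^ 2 + α * ψ t ^ 2 - β * ψ t ≤ ψ t * ψ₂ t)
    (hψ : 0 < ψ 0) (hG : 0 < α * ψ 0 + δ / 2 * (ψ₁ 0 ^ 2 / ψ 0) - β)
    (hpos : ∀ t ∈ Icc 0 T, 0 ≤ ψ₁ t) :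
    ψ 0 ≤ ψ T ∧
      α * ψ 0 + δ / 2 * (ψ₁ 0 ^ 2 / ψ 0) - β ≤ α * ψ T + δ / 2 * (ψ₁ T ^ 2 / ψ T) - β ∧
      α * ψ T + δ / 2 * (ψ₁ T ^ 2 / ψ T) - β ≤ ψ₂ T := by
  have hmono : ∀ t ∈ Icc 0 T, ψ 0 ≤ ψ t := fun t ht =>
    le_of_hasDerivWithinAt_nonneg le_rfl ht.1 (fun s hs => h₀ s hs.1)
      (fun s hs => hpos s ⟨hs.1, hs.2.trans ht.2⟩)
  have hψT := hmono T (right_mem_Icc.2 hT)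
  set G : ℝ → ℝ := fun t => α * ψ t + δ / 2 * (ψ₁ t ^ 2 / ψ t) - β with hGdef
  have hK : G 0 * ψ 0 ^ (-δ) ≤ G T * ψ T ^ (-δ) := by
    refine le_of_hasDerivWithinAt_nonneg (f := fun t => G t * ψ t ^ (-δ)) le_rfl hT
      (f' := fun t => (α * ψ₁ t + δ / 2 * ((2 * ψ₁ t * ψ₂ t * ψ t - ψ₁ t ^ 2 * ψ₁ t) / ψ t ^ 2))
        * ψ t ^ (-δ) + G t * (ψ₁ t * (-δ) * ψ t ^ (-δ - 1))) ?_ ?_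
    · intro t ht
      have hpt : 0 < ψ t := hψ.trans_le (hmono t ht)
      have d2 : HasDerivWithinAt (fun t => ψ₁ t ^ 2) (2 * ψ₁ t * ψ₂ t) (Ici 0) t := by
        simpa using! (h₁ t ht.1).fun_pow 2
      have d1 : HasDerivWithinAt G (α * ψ₁ t +
          δ / 2 * ((2 * ψ₁ t * ψ₂ t * ψ t - ψ₁ t ^ 2 * ψ₁ t) / ψ t ^ 2)) (Ici 0) t :=
        (((h₀ t ht.1).const_mul α).add ((d2.div (h₀ t ht.1) hpt.ne').const_mul (δ / 2))).sub_const β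
      exact d1.mul ((h₀ t ht.1).rpow_const (Or.inl hpt.ne'))
    · intro t ht
      have hpt : 0 < ψ t := hψ.trans_le (hmono t ht)
      have hp1 := hpos t ht
      have hi := hineq t ht.1
      have e : ψ t ^ (-δ) = ψ t ^ (-δ - 1) * ψ t := by
        rw [Real.rpow_sub_one hpt.ne']; field_simp
      have key : (α * ψ₁ t + δ / 2 * ((2 * ψ₁ t * ψ₂ t * ψ t - ψ₁ t ^ 2 * ψ₁ t) / ψ t ^ 2))
          * ψ t ^ (-δ) + G t * (ψ₁ t * (-δ) * ψ t ^ (-δ - 1))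
          = ψ t ^ (-δ - 1) * (α * ψ₁ t * ψ t + δ * ψ₁ t / ψ t *
            (ψ t * ψ₂ t - ((δ + 1) / 2 * ψ₁ t ^ 2 + α * ψ t ^ 2 - β * ψ t))) := by
        rw [e, hGdef]; field_simp; ring
      change 0 ≤ _
      rw [key]
      have := sub_nonneg.2 hi
      positivity
  refine ⟨hψT, ?_, ?_⟩
  · have hpT : 0 < ψ T := hψ.trans_le hψT
    -- Since `ψ` has grown, `ψ^(-δ)` has shrunk, so monotonicity of `Gψ^(-δ)` with `G(0) > 0` forces
    -- `G` to have grown.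
    have h1 : ψ T ^ (-δ) ≤ ψ 0 ^ (-δ) :=
      Real.rpow_le_rpow_of_nonpos hψ hψT (by linarith)
    have hT0 : 0 < ψ T ^ (-δ) := Real.rpow_pos_of_pos hpT _
    have h2 : G 0 * ψ T ^ (-δ) ≤ G T * ψ T ^ (-δ) :=
      (mul_le_mul_of_nonneg_left h1 hG.le).trans hK
    exact le_of_mul_le_mul_right h2 hT0
  · have hpT : 0 < ψ T := hψ.trans_le hψT
    have hi := hineq T hT
    -- The coefficients `(δ+1)/2` and `δ/2` of `ψ'²` leave a surplus of `ψ'²/2`.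
    have : ψ T * G T ≤ ψ T * ψ₂ T := by
      have : ψ T * G T = δ / 2 * ψ₁ T ^ 2 + α * ψ T ^ 2 - β * ψ T := by
        rw [hGdef]; field_simp; ring
      nlinarith [sq_nonneg (ψ₁ T)]
    exact le_of_mul_le_mul_left this hpT

/-- The differential inequality behind the blow up result. -/
lemma false_of_differential_inequality {ψ ψ₁ ψ₂ : ℝ → ℝ} {δ α β : ℝ} (hδ : 1 < δ) (hα : 0 < α)
    (h₀ : ∀ t ∈ Ici (0 : ℝ), HasDerivWithinAt ψ (ψ₁ t) (Ici 0) t)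
    (h₁ : ∀ t ∈ Ici (0 : ℝ), HasDerivWithinAt ψ₁ (ψ₂ t) (Ici 0) t)
    (hineq : ∀ t ∈ Ici (0 : ℝ),
      (δ + 1) / 2 * ψ₁ t ^ 2 + α * ψ t ^ 2 - β * ψ t ≤ ψ t * ψ₂ t)
    (hψ : 0 < ψ 0) (hψ₁ : 0 ≤ ψ₁ 0)
    (hG : 0 < α * ψ 0 + δ / 2 * (ψ₁ 0 ^ 2 / ψ 0) - β) : False := by
  have hcont : ContinuousOn ψ₁ (Ici 0) := fun t ht => (h₁ t ht).continuousWithinAt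
  set c := α * ψ 0 + δ / 2 * (ψ₁ 0 ^ 2 / ψ 0) - β with hc
  have hpos : ∀ t ∈ Ici (0 : ℝ), 0 ≤ ψ₁ t := by
    by_contra! hcon
    obtain ⟨t₁, ht₁, hneg⟩ := hcon
    -- At the infimum `t₀` of the bad times, `ψ' ≥ 0` still holds by continuity, so `ψ''(t₀) ≥ G(0)
    -- > 0`. Then `ψ' ≥ 0` just to the right of `t₀`, which contradicts the choice of `t₀`.
    set B := {t : ℝ | 0 ≤ t ∧ ψ₁ t < 0} with hB
    have hBne : B.Nonempty := ⟨t₁, ht₁, hneg⟩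
    have hBbd : BddBelow B := ⟨0, fun t ht => ht.1⟩
    set t₀ := sInf B with ht₀
    have ht₀0 : 0 ≤ t₀ := le_csInf hBne fun t ht => ht.1
    have hlt : ∀ t, 0 ≤ t → t < t₀ → 0 ≤ ψ₁ t := by
      intro t ht htt
      by_contra! hn
      exact absurd (csInf_le hBbd ⟨ht, hn⟩) (not_le.2 htt)
    have hat : 0 ≤ ψ₁ t₀ := by
      rcases ht₀0.eq_or_lt with h | h
      · rwa [← h]
      · have hc1 : Tendsto ψ₁ (𝓝[Ico 0 t₀] t₀) (𝓝 (ψ₁ t₀)) :=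
          (hcont t₀ ht₀0).mono (fun t ht => ht.1)
        have : (𝓝[Ico 0 t₀] t₀).NeBot := by
          rw [← mem_closure_iff_nhdsWithin_neBot, closure_Ico h.ne]
          exact right_mem_Icc.2 h.le
        exact ge_of_tendsto hc1 (eventually_nhdsWithin_of_forall fun t ht => hlt t ht.1 ht.2)
    have hge : ∀ t ∈ Icc 0 t₀, 0 ≤ ψ₁ t := fun t ht => by
      rcases ht.2.eq_or_lt with h | h
      · rwa [h]
      · exact hlt t ht.1 h
    obtain ⟨-, hG1, hG2⟩ := blowup_functional_pos hδ hα ht₀0 h₀ h₁ hineq hψ hG hge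
    have hψ₂ : 0 < ψ₂ t₀ := hG.trans_le (hG1.trans hG2)
    have hev : ∀ᶠ t in 𝓝[>] t₀, 0 ≤ ψ₁ t := by
      have hs : Tendsto (slope ψ₁ t₀) (𝓝[>] t₀) (𝓝 (ψ₂ t₀)) := by
        have := (h₁ t₀ ht₀0).mono (Ioi_subset_Ici ht₀0)
        rwa [hasDerivWithinAt_iff_tendsto_slope' (by simp)] at this
      filter_upwards [hs.eventually (lt_mem_nhds hψ₂), self_mem_nhdsWithin] with t ht htt
      rw [slope_def_field] at ht
      have := (div_pos_iff_of_pos_right (sub_pos.2 htt)).1 ht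
      linarith
    obtain ⟨s, hs, hs'⟩ := (mem_nhdsGT_iff_exists_Ioo_subset).1 hev
    obtain ⟨t, htB, hts⟩ := exists_lt_of_csInf_lt hBne (show sInf B < s from hs)
    have htt : t₀ ≤ t := csInf_le hBbd htB
    rcases htt.eq_or_lt with h | h
    · exact absurd htB.2 (not_lt.2 (h ▸ hat))
    · exact absurd htB.2 (not_lt.2 (hs' ⟨h, hts⟩))
  have hall : ∀ t ∈ Ici (0 : ℝ), ψ 0 ≤ ψ t ∧ c ≤ ψ₂ t := fun t ht => by
    obtain ⟨h1, h2, h3⟩ := blowup_functional_pos hδ hα ht h₀ h₁ hineq hψ hG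
      (fun s hs => hpos s hs.1)
    exact ⟨h1, h2.trans h3⟩
  have hlin : ∀ t ∈ Ici (0 : ℝ), c * t ≤ ψ₁ t := fun t ht => by
    have := le_of_hasDerivWithinAt_nonneg (f := fun s => ψ₁ s - c * s) (f' := fun s => ψ₂ s - c * 1)
      le_rfl ht (fun s hs => (h₁ s hs.1).sub ((hasDerivWithinAt_id s _).const_mul c))
      (fun s hs => by simpa using (hall s hs.1).2)
    simp only [mul_zero, sub_zero] at this
    linarith
  have hquad : ∀ t ∈ Ici (0 : ℝ), c * t ^ 2 / 2 ≤ ψ t := fun t ht => by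
    have := le_of_hasDerivWithinAt_nonneg (f := fun s => ψ s - c / 2 * s ^ 2)
      (f' := fun s => ψ₁ s - c / 2 * (2 * s))
      le_rfl ht (fun s hs => by
        simpa using! (h₀ s hs.1).sub (((hasDerivWithinAt_id s _).fun_pow 2).const_mul (c / 2)))
      (fun s hs => by have := hlin s hs.1; linarith)
    simp only [ne_eq, OfNat.ofNat_ne_zero, not_false_eq_true, zero_pow, mul_zero, sub_zero] at this
    linarith
  obtain ⟨T, hT1, hT2⟩ : ∃ T : ℝ, 1 ≤ T ∧ β / α ≤ c * T ^ 2 / 2 := by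
    -- For `T ≥ 1` one has `cT²/2 ≥ cT/2`, and the second entry makes this at least `β/α`. The bound
    -- `T ≥ 1` also yields `ψ'(T) ≥ cT > 0` below.
    refine ⟨max 1 (2 * (β / α) / c), le_max_left _ _, ?_⟩
    have h1 := le_max_left 1 (2 * (β / α) / c)
    have h2 := le_max_right 1 (2 * (β / α) / c)
    rw [div_le_iff₀ hG] at h2
    set y := max 1 (2 * (β / α) / c)
    nlinarith [mul_nonneg (mul_nonneg hG.le (zero_le_one.trans h1)) (sub_nonneg.2 h1)]
  have hT0 : (0 : ℝ) ≤ T := by linarith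
  have hbig : ∀ t, T ≤ t → β ≤ α * ψ t := fun t ht => by
    have h1 := le_of_hasDerivWithinAt_nonneg hT0 ht (fun s hs => h₀ s (hT0.trans hs.1))
      (fun s hs => hpos s (hT0.trans hs.1))
    have h2 := hT2.trans ((hquad T hT0).trans h1)
    rwa [div_le_iff₀ hα, mul_comm] at h2
  have hψp : ∀ t ∈ Ici (0 : ℝ), 0 < ψ t := fun t ht => hψ.trans_le (hall t ht).1
  set γ := (δ + 1) / 2 with hγ
  -- Here `m = (ψ^(1-γ))'/(1-γ)`, so monotonicity of `m` is concavity of `ψ^(1-γ)`. It follows from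
  -- `ψψ'' ≥ γψ'²`, valid once `αψ ≥ β`.
  set m : ℝ → ℝ := fun t => ψ t ^ (-γ) * ψ₁ t with hm
  have hmge : ∀ t, T ≤ t → m T ≤ m t := fun t ht => by
    refine le_of_hasDerivWithinAt_nonneg hT0 ht
      (f' := fun s => (ψ₁ s * (-γ) * ψ s ^ (-γ - 1)) * ψ₁ s + ψ s ^ (-γ) * ψ₂ s)
      (fun s hs => ((h₀ s (hT0.trans hs.1)).rpow_const
        (Or.inl (hψp s (hT0.trans hs.1)).ne')).mul (h₁ s (hT0.trans hs.1))) ?_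
    intro s hs
    have hps := hψp s (hT0.trans hs.1)
    have hi := hineq s (hT0.trans hs.1)
    have hb := hbig s hs.1
    have e : ψ s ^ (-γ) = ψ s ^ (-γ - 1) * ψ s := by
      rw [Real.rpow_sub_one hps.ne']; field_simp
    have : (ψ₁ s * (-γ) * ψ s ^ (-γ - 1)) * ψ₁ s + ψ s ^ (-γ) * ψ₂ s
        = ψ s ^ (-γ - 1) * (ψ s * ψ₂ s - γ * ψ₁ s ^ 2) := by rw [e]; ring
    rw [this]
    refine mul_nonneg (Real.rpow_nonneg hps.le _) ?_
    nlinarith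
  have hmT : 0 < m T := mul_pos (Real.rpow_pos_of_pos (hψp T hT0) _)
    ((mul_pos hG (by linarith)).trans_le (hlin T hT0))
  have hφ : ∀ t, T ≤ t → (γ - 1) * m T * (t - T) ≤ ψ T ^ (1 - γ) := fun t ht => by
    have := le_of_hasDerivWithinAt_nonneg
      (f := fun s => -(ψ s ^ (1 - γ)) - (γ - 1) * m T * s)
      (f' := fun s => -(ψ₁ s * (1 - γ) * ψ s ^ (1 - γ - 1)) - (γ - 1) * m T * 1) hT0 ht
      (fun s hs => (((h₀ s (hT0.trans hs.1)).rpow_const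
        (Or.inl (hψp s (hT0.trans hs.1)).ne')).neg).sub
          ((hasDerivWithinAt_id s _).const_mul _)) (fun s hs => by
        have h1 := hmge s hs.1
        have e : (1 - γ - 1) = -γ := by ring
        rw [e]
        have : -(ψ₁ s * (1 - γ) * ψ s ^ (-γ)) - (γ - 1) * m T * 1
            = (γ - 1) * (m s - m T) := by rw [hm]; ring
        rw [this]
        exact mul_nonneg (by linarith) (by linarith))
    have h2 : 0 < ψ t ^ (1 - γ) := Real.rpow_pos_of_pos (hψp t (hT0.trans ht)) _
    linarith
  have hk : 0 < (γ - 1) * m T := mul_pos (by linarith) hmT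
  have hψT : 0 < ψ T ^ (1 - γ) := Real.rpow_pos_of_pos (hψp T hT0) _
  -- This is twice the waiting time after which the tangent line of `ψ^(1-γ)` at `T` reaches zero.
  have := hφ (T + 2 * (ψ T ^ (1 - γ) / ((γ - 1) * m T))) (by
    have := (div_pos hψT hk).le
    linarith)
  have e : (γ - 1) * m T * (T + 2 * (ψ T ^ (1 - γ) / ((γ - 1) * m T)) - T)
      = 2 * ψ T ^ (1 - γ) := by
    rw [add_sub_cancel_left, mul_left_comm, mul_div_cancel₀ _ hk.ne']
  rw [e] at this
  linarith

/-! ### Calculus on the half line and time averages. -/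

section Calculus

variable {X : Type*} [NormedAddCommGroup X] [NormedSpace ℝ X]

/-- Extending a curve by its initial value to negative times lets two-sided calculus apply to data
given on `[0,∞)`. -/
lemma continuous_comp_max {X : Type*} [TopologicalSpace X] {c : ℝ → X} (hc : ContinuousOn c (Ici 0)) :
    Continuous fun t => c (max t 0) :=
  hc.comp_continuous (by fun_prop) fun t => le_max_right t 0

lemma integral_comp_max {c : ℝ → X} {t : ℝ} (ht : 0 ≤ t) :
    ∫ s in (0 : ℝ)..t, c (max s 0) = ∫ s in (0 : ℝ)..t, c s := by
  refine intervalIntegral.integral_congr fun s hs => ?_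
  rw [uIcc_of_le ht] at hs
  simp only [max_eq_left hs.1]

lemma norm_average_le {c : ℝ → X} {M T t h : ℝ} (hc : Continuous c)
    (hM : ∀ s ∈ Icc 0 (T + 1), ‖c s‖ ≤ M) (ht : t ∈ Icc 0 T) (hh : h ∈ Ioc (0 : ℝ) 1) :
    ‖h⁻¹ • ((∫ s in (0 : ℝ)..t + h, c s) - ∫ s in (0 : ℝ)..t, c s)‖ ≤ M := by
  rw [intervalIntegral.integral_interval_sub_left (hc.intervalIntegrable _ _)
    (hc.intervalIntegrable _ _), norm_smul, Real.norm_eq_abs, abs_of_pos (inv_pos.2 hh.1)]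
  have := intervalIntegral.norm_integral_le_of_norm_le_const (a := t) (b := t + h) (f := c)
    (C := M) (fun s hs => by
      rw [uIoc_of_le (by linarith [hh.1])] at hs
      exact hM s ⟨ht.1.trans hs.1.le, hs.2.trans (add_le_add ht.2 hh.2)⟩)
  rw [add_sub_cancel_left, abs_of_pos hh.1] at this
  rw [inv_mul_le_iff₀ hh.1]
  linarith

variable [CompleteSpace X]

lemma hasDerivWithinAt_integral_Ici {c : ℝ → X} (hc : ContinuousOn c (Ici 0)) {t : ℝ}
    (ht : 0 ≤ t) : HasDerivWithinAt (fun t => ∫ s in (0 : ℝ)..t, c s) (c t) (Ici 0) t := by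
  have h1 := ((continuous_comp_max hc).integral_hasStrictDerivAt 0 t).hasDerivAt
  simp only [max_eq_left ht] at h1
  exact h1.hasDerivWithinAt.congr (fun s hs => (integral_comp_max hs).symm)
    (integral_comp_max ht).symm

lemma integral_eq_sub_Ici {x c : ℝ → X} (hx : ∀ t ∈ Ici (0 : ℝ), HasDerivWithinAt x (c t) (Ici 0) t)
    (hc : ContinuousOn c (Ici 0)) {t : ℝ} (ht : 0 ≤ t) :
    ∫ s in (0 : ℝ)..t, c s = x t - x 0 := by
  refine intervalIntegral.integral_eq_sub_of_hasDerivAt_of_le ht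
    (fun s hs => ((hx s hs.1).continuousWithinAt).mono fun r hr => hr.1)
    (fun s hs => (hx s hs.1.le).hasDerivAt (Ici_mem_nhds hs.1)) ?_
  refine ContinuousOn.intervalIntegrable ?_
  rw [uIcc_of_le ht]
  exact hc.mono fun r hr => hr.1

lemma hasDerivAt_average {c : ℝ → X} (hc : Continuous c) (h t : ℝ) :
    HasDerivAt (fun t => h⁻¹ • ((∫ s in (0 : ℝ)..t + h, c s) - ∫ s in (0 : ℝ)..t, c s))
      (h⁻¹ • (c (t + h) - c t)) t := by
  have h0 : ∀ t, HasDerivAt (fun t => ∫ s in (0 : ℝ)..t, c s) (c t) t := fun t =>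
    (hc.integral_hasStrictDerivAt 0 t).hasDerivAt
  exact (((h0 (t + h)).comp_add_const t h).sub (h0 t)).const_smul h⁻¹

lemma tendsto_average {c : ℝ → X} (hc : Continuous c) (t : ℝ) :
    Tendsto (fun h => h⁻¹ • ((∫ s in (0 : ℝ)..t + h, c s) - ∫ s in (0 : ℝ)..t, c s))
      (𝓝[>] 0) (𝓝 (c t)) :=
  (hc.integral_hasStrictDerivAt 0 t).hasDerivAt.tendsto_slope_zero_right

end Calculus

/-! ### Energy identity and chain rule in abstract Hilbert spaces. -/

section Energy

variable {H L V : Type*} [NormedAddCommGroup H] [InnerProductSpace ℝ H]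
  [NormedAddCommGroup L] [InnerProductSpace ℝ L]
  [NormedAddCommGroup V] [InnerProductSpace ℝ V]

/-- The velocity lies only in `L` and is not an admissible test function. The equation is therefore
averaged over `[t, t+h]`; the averaged velocity is the image of a difference quotient of `u`, which
lies in `H`. The averaged identity is exact, and `h → 0` by dominated convergence. -/
lemma continuous_energy_identity [CompleteSpace L] [CompleteSpace V]
    {j : H →L[ℝ] L} {D : H →L[ℝ] V} {u : ℝ → H} {v g : ℝ → L}
    (hu : Continuous u) (hv : Continuous v) (hg : Continuous g)
    (huv : ∀ t, 0 ≤ t → j (u t) = j (u 0) + ∫ s in (0 : ℝ)..t, v s)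
    (hweak : ∀ η : H, ∀ t, 0 ≤ t →
      inner ℝ (v t) (j η) + ∫ s in (0 : ℝ)..t, inner ℝ (D (u s)) (D η)
        = (∫ s in (0 : ℝ)..t, inner ℝ (g s) (j η)) + inner ℝ (v 0) (j η))
    {T : ℝ} (hT : 0 ≤ T) :
    (1 / 2) * (‖v T‖ ^ 2 + ‖D (u T)‖ ^ 2) - (1 / 2) * (‖v 0‖ ^ 2 + ‖D (u 0)‖ ^ 2)
      = ∫ t in (0 : ℝ)..T, inner ℝ (g t) (v t) := by
  set U : ℝ → V := fun t => ∫ s in (0 : ℝ)..t, D (u s) with hU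
  set W : ℝ → L := fun t => ∫ s in (0 : ℝ)..t, v s with hW
  set G : ℝ → L := fun t => ∫ s in (0 : ℝ)..t, g s with hG
  have hDu : Continuous fun t => D (u t) := D.continuous.comp hu
  have hweak' : ∀ η : H, ∀ t, 0 ≤ t →
      inner ℝ (v t) (j η) + inner ℝ (U t) (D η) = inner ℝ (G t) (j η) + inner ℝ (v 0) (j η) := by
    intro η t ht
    have h1 : ∫ s in (0 : ℝ)..t, inner ℝ (D (u s)) (D η) = inner ℝ (U t) (D η) := by
      simp only [real_inner_comm (D η)]
      exact (innerSL ℝ (D η)).intervalIntegral_comp_comm (hDu.intervalIntegrable _ _)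
    have h2 : ∫ s in (0 : ℝ)..t, inner ℝ (g s) (j η) = inner ℝ (G t) (j η) := by
      simp only [real_inner_comm (j η)]
      exact (innerSL ℝ (j η)).intervalIntegral_comp_comm (hg.intervalIntegrable _ _)
    rw [← h1, ← h2]
    exact hweak η t ht
  set y : ℝ → ℝ → V := fun h t => h⁻¹ • (U (t + h) - U t) with hy
  set w : ℝ → ℝ → L := fun h t => h⁻¹ • (W (t + h) - W t) with hw
  set k : ℝ → ℝ → L := fun h t => h⁻¹ • (G (t + h) - G t) with hk
  have hUc : Continuous U := intervalIntegral.continuous_primitive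
    (fun a b => hDu.intervalIntegrable a b) 0
  have hWc : Continuous W := intervalIntegral.continuous_primitive
    (fun a b => hv.intervalIntegrable a b) 0
  have hGc : Continuous G := intervalIntegral.continuous_primitive
    (fun a b => hg.intervalIntegrable a b) 0
  have hkc : ∀ h, Continuous fun t => inner ℝ (k h t) (w h t) := by
    intro h
    simp only [hk, hw]
    fun_prop
  have hstep : ∀ h, 0 < h →
      (1 / 2) * (‖w h T‖ ^ 2 + ‖y h T‖ ^ 2) - (1 / 2) * (‖w h 0‖ ^ 2 + ‖y h 0‖ ^ 2)
      = ∫ t in (0 : ℝ)..T, inner ℝ (k h t) (w h t) := by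
    intro h hh
    have hd : ∀ t, 0 ≤ t → HasDerivAt (fun t => (1 / 2) * (‖w h t‖ ^ 2 + ‖y h t‖ ^ 2))
        (inner ℝ (k h t) (w h t)) t := by
      intro t ht
      have h1 := (hasDerivAt_average hv h t).norm_sq
      have h2 := (hasDerivAt_average hDu h t).norm_sq
      have h3 := (h1.add h2).const_mul (1 / 2)
      refine h3.congr_deriv ?_
      -- With this test function, `j η = w` and `D η = y'`. The weak identities at `t+h` and `t`,
      -- subtracted and divided by `h`, then read `(w', w) + (y, y') = (k, w)`.
      set η : H := h⁻¹ • (u (t + h) - u t) with hη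
      have e1 : j η = w h t := by
        simp only [hη, hw, map_smul, map_sub, huv t ht, huv (t + h) (by linarith)]
        simp [hW]
      have e2 : D η = h⁻¹ • (D (u (t + h)) - D (u t)) := by
        simp only [hη, map_smul, map_sub]
      have e3 := hweak' η t ht
      have e4 := hweak' η (t + h) (by linarith)
      have e5 : inner ℝ (h⁻¹ • (v (t + h) - v t)) (j η) + inner ℝ (y h t) (D η)
          = inner ℝ (k h t) (j η) := by
        simp only [hy, hk, real_inner_smul_left, inner_sub_left]
        linear_combination h⁻¹ * (e4 - e3)
      rw [e1, e2] at e5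
      change 1 / 2 * (2 * inner ℝ (w h t) (h⁻¹ • (v (t + h) - v t)) +
        2 * inner ℝ (y h t) (h⁻¹ • (D (u (t + h)) - D (u t)))) = _
      rw [real_inner_comm (h⁻¹ • (v (t + h) - v t)) (w h t), ← e5]
      ring
    refine (intervalIntegral.integral_eq_sub_of_hasDerivAt (fun t ht => hd t ?_)
      ((hkc h).intervalIntegrable _ _)).symm
    rw [uIcc_of_le hT] at ht
    exact ht.1
  have hlim1 : Tendsto (fun h => (1 / 2) * (‖w h T‖ ^ 2 + ‖y h T‖ ^ 2)
      - (1 / 2) * (‖w h 0‖ ^ 2 + ‖y h 0‖ ^ 2)) (𝓝[>] 0)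
      (𝓝 ((1 / 2) * (‖v T‖ ^ 2 + ‖D (u T)‖ ^ 2) - (1 / 2) * (‖v 0‖ ^ 2 + ‖D (u 0)‖ ^ 2))) := by
    have hn : ∀ t, Tendsto (fun h => (1 / 2) * (‖w h t‖ ^ 2 + ‖y h t‖ ^ 2)) (𝓝[>] 0)
        (𝓝 ((1 / 2) * (‖v t‖ ^ 2 + ‖D (u t)‖ ^ 2))) := fun t =>
      (((tendsto_average hv t).norm.pow 2).add ((tendsto_average hDu t).norm.pow 2)).const_mul _
    exact (hn T).sub (hn 0)
  have hlim2 : Tendsto (fun h => ∫ t in (0 : ℝ)..T, inner ℝ (k h t) (w h t)) (𝓝[>] 0)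
      (𝓝 (∫ t in (0 : ℝ)..T, inner ℝ (g t) (v t))) := by
    obtain ⟨M₁, hM₁⟩ := (isCompact_Icc (a := (0 : ℝ)) (b := T + 1)).exists_bound_of_continuousOn
      hv.continuousOn
    obtain ⟨M₂, hM₂⟩ := (isCompact_Icc (a := (0 : ℝ)) (b := T + 1)).exists_bound_of_continuousOn
      hg.continuousOn
    refine intervalIntegral.tendsto_integral_filter_of_dominated_convergence
      (fun _ => M₂ * M₁) ?_ ?_ (by simp) ?_
    · exact Eventually.of_forall fun h => (hkc h).aestronglyMeasurable
    · filter_upwards [Ioc_mem_nhdsGT (zero_lt_one (α := ℝ))] with h hh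
      refine Eventually.of_forall fun t ht => ?_
      rw [uIoc_of_le hT] at ht
      have ht' : t ∈ Icc 0 T := ⟨ht.1.le, ht.2⟩
      have b1 := norm_average_le hv hM₁ ht' hh
      have b2 := norm_average_le hg hM₂ ht' hh
      exact (norm_inner_le_norm _ _).trans
        (mul_le_mul b2 b1 (norm_nonneg _) ((norm_nonneg _).trans b2))
    · exact Eventually.of_forall fun t _ => (tendsto_average hg t).inner (tendsto_average hv t)
  refine tendsto_nhds_unique hlim1 (hlim2.congr' ?_)
  filter_upwards [self_mem_nhdsWithin] with h hh
  exact (hstep h hh).symm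

/-- The energy identity for weak solutions of linear wave equations. -/
lemma energy_identity [CompleteSpace L] [CompleteSpace V]
    {j : H →L[ℝ] L} {D : H →L[ℝ] V} {u : ℝ → H} {v g : ℝ → L}
    (hu : ContinuousOn u (Ici 0)) (hv : ContinuousOn v (Ici 0)) (hg : ContinuousOn g (Ici 0))
    (huv : ∀ t ∈ Ici (0 : ℝ), HasDerivWithinAt (fun s => j (u s)) (v t) (Ici 0) t)
    (hweak : ∀ η : H, ∀ t, 0 ≤ t →
      inner ℝ (v t) (j η) + ∫ s in (0 : ℝ)..t, inner ℝ (D (u s)) (D η)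
        = (∫ s in (0 : ℝ)..t, inner ℝ (g s) (j η)) + inner ℝ (v 0) (j η))
    {T : ℝ} (hT : 0 ≤ T) :
    (1 / 2) * (‖v T‖ ^ 2 + ‖D (u T)‖ ^ 2) - (1 / 2) * (‖v 0‖ ^ 2 + ‖D (u 0)‖ ^ 2)
      = ∫ t in (0 : ℝ)..T, inner ℝ (g t) (v t) := by
  have := continuous_energy_identity (j := j) (D := D) (continuous_comp_max hu)
    (continuous_comp_max hv) (continuous_comp_max hg) (fun t ht => by
      rw [integral_comp_max ht, integral_eq_sub_Ici huv hv ht, max_eq_left ht, max_self]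
      abel) (fun η t ht => by
      have e1 := integral_comp_max (c := fun s => inner ℝ (D (u s)) (D η)) ht
      have e2 := integral_comp_max (c := fun s => inner ℝ (g s) (j η)) ht
      rw [e1, e2, max_eq_left ht, max_self]
      exact hweak η t ht) hT
  rw [max_eq_left hT, max_self] at this
  rw [this]
  exact integral_comp_max (c := fun s => inner ℝ (g s) (v s)) hT

/-- The chain rule along a curve that is continuous in `H` and differentiable in `L`. -/
lemma hasDerivWithinAt_comp_curve {j : H →L[ℝ] L} {Φ : H → ℝ} {Γ : H → L} {R : H → H → ℝ}
    (hΦ : ∀ a b, |Φ b - Φ a - inner ℝ (Γ a) (j b - j a)| ≤ R a b * ‖j b - j a‖)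
    (hR : ∀ a, Tendsto (R a) (𝓝 a) (𝓝 0)) {u : ℝ → H} {v : L} {s : Set ℝ} {t : ℝ}
    (hu : ContinuousWithinAt u s t)
    (huv : HasDerivWithinAt (fun s => j (u s)) v s t) :
    HasDerivWithinAt (fun s => Φ (u s)) (inner ℝ (Γ (u t)) v) s t := by
  have h1 : HasDerivWithinAt (fun r => inner ℝ (Γ (u t)) (j (u r))) (inner ℝ (Γ (u t)) v) s t := by
    simpa using! (hasDerivWithinAt_const t s (Γ (u t))).inner ℝ huv
  rw [hasDerivWithinAt_iff_isLittleO] at h1 ⊢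
  have h2 : (fun r => Φ (u r) - Φ (u t) - inner ℝ (Γ (u t)) (j (u r) - j (u t)))
      =o[𝓝[s] t] fun r => r - t := by
    have h3 : (fun r => Φ (u r) - Φ (u t) - inner ℝ (Γ (u t)) (j (u r) - j (u t)))
        =O[𝓝[s] t] fun r => R (u t) (u r) * ‖j (u r) - j (u t)‖ :=
      Asymptotics.isBigO_of_le _ fun r => (hΦ _ _).trans (le_abs_self _)
    have h4 : (fun r => R (u t) (u r)) =o[𝓝[s] t] fun _ => (1 : ℝ) :=
      (Asymptotics.isLittleO_one_iff ℝ).2 ((hR (u t)).comp hu)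
    have h5 : (fun r => ‖j (u r) - j (u t)‖) =O[𝓝[s] t] fun r => r - t := by
      have := (hasDerivWithinAt_iff_hasFDerivWithinAt.1 huv).isBigO_sub
      exact this.norm_left
    simpa using h3.trans_isLittleO (h4.mul_isBigO h5)
  refine (h2.add h1).congr_left fun r => ?_
  simp only [inner_sub_right, smul_eq_mul]
  ring

end Energy

/-! ### Sobolev inequality on a bounded set. -/

section

variable {n : ℕ} {Ω : Set (E n)}

lemma IsTest.contDiff_one {φ : E n → ℝ} (h : IsTest Ω φ) : ContDiff ℝ 1 φ :=
  h.1.of_le (by exact_mod_cast le_top)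

lemma IsTest.support_subset {φ : E n → ℝ} (h : IsTest Ω φ) : Function.support φ ⊆ Ω :=
  (subset_tsupport φ).trans h.2.2

lemma IsTest.support_fderiv_subset {φ : E n → ℝ} (h : IsTest Ω φ) :
    Function.support (fderiv ℝ φ) ⊆ Ω :=
  (_root_.support_fderiv_subset ℝ).trans h.2.2

lemma IsTest.eLpNorm_fderiv_restrict {φ : E n → ℝ} (h : IsTest Ω φ) (p : ℝ≥0∞) :
    eLpNorm (fderiv ℝ φ) p (volume.restrict Ω) = eLpNorm (fderiv ℝ φ) p volume := by
  rw [← eLpNorm_norm, ← eLpNorm_norm (fderiv ℝ φ)]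
  refine eLpNorm_restrict_eq_of_support_subset ?_
  simpa using! h.support_fderiv_subset

lemma IsTest.eLpNorm_fderiv_le {φ : E n → ℝ} (h : IsTest Ω φ) {p : ℝ≥0∞} (hp : p ≤ 2) :
    eLpNorm (fderiv ℝ φ) p volume ≤
      volume Ω ^ (1 / p.toReal - 1 / 2) * eLpNorm (fderiv ℝ φ) 2 volume := by
  rw [← h.eLpNorm_fderiv_restrict p, ← h.eLpNorm_fderiv_restrict 2, mul_comm]
  have := eLpNorm_le_eLpNorm_mul_rpow_measure_univ (μ := volume.restrict Ω) hp
    (h.contDiff_one.continuous_fderiv (by simp)).aestronglyMeasurable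
  simpa using this

/-- Dimension one needs its own argument, because the Gagliardo–Nirenberg–Sobolev inequality
requires an exponent `1 ≤ p < n`. Here the fundamental theorem of calculus on the line suffices. -/
lemma enorm_le_lintegral_fderiv {φ : E 1 → ℝ} (hφ : ContDiff ℝ 1 φ) (hc : HasCompactSupport φ)
    (x : E 1) : ‖φ x‖ₑ ≤ ∫⁻ y, ‖fderiv ℝ φ y‖ₑ := by
  let e : ℝ ≃ₗᵢ[ℝ] E 1 := (OrthonormalBasis.singleton (Fin 1) ℝ).repr
  have hd : ∀ t, HasDerivAt (φ ∘ e) (fderiv ℝ φ (e t) (e 1)) t := fun t => by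
    have h1 : HasFDerivAt φ (fderiv ℝ φ (e t)) (e t) :=
      (hφ.differentiable (by simp) _).hasFDerivAt
    have h2 : HasDerivAt e (e 1) t :=
      e.toContinuousLinearEquiv.toContinuousLinearMap.hasDerivAt
    exact h1.comp_hasDerivAt t h2
  have h := HasCompactSupport.enorm_le_lintegral_Ici_deriv (f := φ ∘ e)
    (hφ.comp e.contDiff) (hc.comp_homeomorph e.toHomeomorph) (e.symm x)
  simp only [Function.comp_apply, LinearIsometryEquiv.apply_symm_apply] at h
  calc ‖φ x‖ₑ ≤ ∫⁻ y, ‖deriv (φ ∘ e) y‖ₑ := h.trans (setLIntegral_le_lintegral _ _)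
    _ ≤ ∫⁻ y, ‖fderiv ℝ φ (e y)‖ₑ := by
        refine lintegral_mono fun y => ?_
        rw [(hd y).deriv]
        have := (fderiv ℝ φ (e y)).le_opENorm (e 1)
        have h1 : ‖e 1‖ₑ = 1 := by rw [← ofReal_norm, e.norm_map]; simp
        rwa [h1, mul_one] at this
    _ = ∫⁻ y, ‖fderiv ℝ φ y‖ₑ :=
        e.measurePreserving.lintegral_comp_emb e.toHomeomorph.measurableEmbedding
          (fun y => ‖fderiv ℝ φ y‖ₑ)

/-- The Sobolev inequality for test functions on a bounded set. -/
lemma exists_sobolev_const_test (hn : 1 ≤ n) (hΩb : Bornology.IsBounded Ω) {m : ℝ≥0} (hm : 2 ≤ m)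
    (hmn : 3 ≤ n → (m : ℝ) ≤ 2 * n / (n - 2)) :
    ∃ S : ℝ≥0, ∀ φ : E n → ℝ, IsTest Ω φ →
      eLpNorm φ m volume ≤ S * eLpNorm (fderiv ℝ φ) 2 volume := by
  have hfin : volume Ω ≠ ∞ := hΩb.measure_lt_top.ne
  have hm2 : (2 : ℝ) ≤ m := by exact_mod_cast hm
  have hm0 : (0 : ℝ) < m := by linarith
  -- The Sobolev inequality holds with `∇φ` in `L^p`; for `p ≤ 2` the finite measure of `Ω` passes
  -- to `L²`.
  have key : ∀ p : ℝ≥0, 1 ≤ p → p ≤ 2 → (p : ℝ) < n → (p : ℝ)⁻¹ - (n : ℝ)⁻¹ ≤ (m : ℝ)⁻¹ →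
      ∃ S : ℝ≥0, ∀ φ : E n → ℝ, IsTest Ω φ →
      eLpNorm φ m volume ≤ S * eLpNorm (fderiv ℝ φ) 2 volume := by
    intro p hp hp2 hpn hpm
    refine ⟨eLpNormLESNormFDerivOfLeConst ℝ (volume : Measure (E n)) Ω p m *
      (volume Ω ^ (1 / (p : ℝ) - 1 / 2)).toNNReal, fun φ hφ => ?_⟩
    have hexp : 0 ≤ 1 / (p : ℝ) - 1 / 2 := by
      have hp0 : (0 : ℝ) < p := by exact_mod_cast zero_lt_one.trans_le hp
      have : (p : ℝ) ≤ 2 := by exact_mod_cast hp2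
      rw [sub_nonneg]
      exact one_div_le_one_div_of_le hp0 this
    have h1 := eLpNorm_le_eLpNorm_fderiv_of_le (μ := (volume : Measure (E n)))
      hφ.contDiff_one hφ.support_subset hp (q := m) 
      (by simpa using (by exact_mod_cast hpn : p < (n : ℝ≥0))) (by simpa using hpm) hΩb
    have h2 := hφ.eLpNorm_fderiv_le (p := p) (by exact_mod_cast hp2)
    rw [ENNReal.coe_mul, ENNReal.coe_toNNReal (ENNReal.rpow_ne_top_of_nonneg hexp hfin), mul_assoc]
    exact h1.trans (by gcongr; simpa using h2)
  rcases (by omega : n = 1 ∨ n = 2 ∨ 3 ≤ n) with rfl | rfl | h3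
  · refine ⟨(volume Ω ^ (1 / (m : ℝ))).toNNReal * (volume Ω ^ (1 / 2 : ℝ)).toNNReal,
      fun φ hφ => ?_⟩
    rw [ENNReal.coe_mul, ENNReal.coe_toNNReal (ENNReal.rpow_ne_top_of_nonneg (by positivity) hfin),
      ENNReal.coe_toNNReal (ENNReal.rpow_ne_top_of_nonneg (by positivity) hfin), mul_assoc]
    have h2 := hφ.eLpNorm_fderiv_le (p := 1) (by norm_num)
    have e : (1 : ℝ) / (1 : ℝ≥0∞).toReal - 1 / 2 = 1 / 2 := by norm_num
    rw [e] at h2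
    have h1 : eLpNorm φ ∞ (volume.restrict Ω) ≤ eLpNorm (fderiv ℝ φ) 1 volume := by
      rw [eLpNorm_one_eq_lintegral_enorm, eLpNorm_exponent_top]
      exact essSup_le_of_ae_le _ (Eventually.of_forall
        fun x => enorm_le_lintegral_fderiv hφ.contDiff_one hφ.2.1 x)
    have h3 := eLpNorm_le_eLpNorm_mul_rpow_measure_univ (μ := volume.restrict Ω)
      (p := m) (q := ∞) le_top hφ.1.continuous.aestronglyMeasurable
    rw [eLpNorm_restrict_eq_of_support_subset hφ.support_subset, mul_comm] at h3
    simp only [Measure.restrict_apply_univ, ENNReal.coe_toReal, ENNReal.toReal_top, div_zero,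
      sub_zero] at h3
    exact h3.trans (by gcongr; exact h1.trans h2)
  · have h1 : (0 : ℝ) < (m : ℝ)⁻¹ := by positivity
    have h2 : (m : ℝ)⁻¹ ≤ 2⁻¹ := inv_anti₀ (by norm_num) hm2
    -- In the plane `p = 2` is excluded by `p < n`; this `p` is the one whose Sobolev conjugate is
    -- exactly `m`.
    refine key (m⁻¹ + 2⁻¹)⁻¹ ?_ ?_ ?_ ?_
    · rw [← NNReal.coe_le_coe]
      push_cast
      exact (one_le_inv₀ (by positivity)).2 (by linarith)
    · rw [← NNReal.coe_le_coe]
      push_cast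
      rw [inv_le_comm₀ (by positivity) (by norm_num)]
      linarith
    · push_cast
      rw [inv_lt_comm₀ (by positivity) (by norm_num)]
      linarith
    · push_cast
      rw [inv_inv]
      linarith
  · have h3' : (3 : ℝ) ≤ n := by exact_mod_cast h3
    refine key 2 (by norm_num) le_rfl (by push_cast; linarith) ?_
    have := inv_anti₀ hm0 (hmn h3)
    refine le_trans (le_of_eq ?_) this
    push_cast
    have : (n : ℝ) - 2 ≠ 0 := by linarith
    field_simp

/-- The generating set is already a linear subspace, so an estimate for single test functions covers
the whole span. -/
lemma exists_isTest_of_mem_span {w : WithLp 2 (L2 Ω × L2Vec Ω)}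
    (hw : w ∈ Submodule.span ℝ {w : WithLp 2 (L2 Ω × L2Vec Ω) | ∃ φ : E n → ℝ, IsTest Ω φ ∧
      w.fst =ᵐ[volume.restrict Ω] φ ∧
      w.snd =ᵐ[volume.restrict Ω] fun x => gradient φ x}) :
    ∃ φ : E n → ℝ, IsTest Ω φ ∧ w.fst =ᵐ[volume.restrict Ω] φ ∧
      w.snd =ᵐ[volume.restrict Ω] fun x => gradient φ x := by
  induction hw using Submodule.span_induction with
  | mem x h => exact h
  | zero =>
    refine ⟨0, ⟨contDiff_const, HasCompactSupport.zero, by simp⟩, Lp.coeFn_zero _ _ _, ?_⟩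
    filter_upwards [Lp.coeFn_zero (E n) 2 (volume.restrict Ω)] with x hx
    have : gradient (0 : E n → ℝ) x = 0 := by
      simp [gradient]
    rw [this]
    exact hx
  | add x y _ _ hx hy =>
    obtain ⟨φ, hφ, h1, h2⟩ := hx
    obtain ⟨χ, hχ, h3, h4⟩ := hy
    refine ⟨φ + χ, ⟨hφ.1.add hχ.1, hφ.2.1.add hχ.2.1,
      (tsupport_add φ χ).trans (union_subset hφ.2.2 hχ.2.2)⟩, ?_, ?_⟩
    · exact (Lp.coeFn_add x.fst y.fst).trans (h1.add h3)
    · refine (Lp.coeFn_add x.snd y.snd).trans ((h2.add h4).trans (Eventually.of_forall fun z => ?_))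
      simp only [Pi.add_apply, gradient]
      rw [fderiv_add (hφ.contDiff_one.differentiable (by simp) z)
        (hχ.contDiff_one.differentiable (by simp) z), map_add]
  | smul c x _ hx =>
    obtain ⟨φ, hφ, h1, h2⟩ := hx
    refine ⟨c • φ, ⟨hφ.1.const_smul c, hφ.2.1.smul_left (f := fun _ => c),
      (tsupport_smul_subset_right (fun _ => c) φ).trans hφ.2.2⟩, ?_, ?_⟩
    · exact (Lp.coeFn_smul c x.fst).trans (h1.const_smul c)
    · refine (Lp.coeFn_smul c x.snd).trans ((h2.const_smul c).trans
        (Eventually.of_forall fun z => ?_))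
      simp only [Pi.smul_apply, gradient]
      rw [fderiv_const_smul (hφ.contDiff_one.differentiable (by simp) z), map_smul]

lemma enorm_snd_le (w : WithLp 2 (L2 Ω × L2Vec Ω)) : ‖w.snd‖ₑ ≤ ‖w‖ₑ := by
  rw [← ofReal_norm, ← ofReal_norm]
  refine ENNReal.ofReal_le_ofReal ?_
  rw [WithLp.prod_norm_eq_of_L2]
  exact Real.le_sqrt_of_sq_le (le_add_of_nonneg_left (by positivity))

lemma eLpNorm_fst_le_of_mem_span {m : ℝ≥0} {S : ℝ≥0}
    (hS : ∀ φ : E n → ℝ, IsTest Ω φ →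
      eLpNorm φ m volume ≤ S * eLpNorm (fderiv ℝ φ) 2 volume)
    {w : WithLp 2 (L2 Ω × L2Vec Ω)}
    (hw : w ∈ Submodule.span ℝ {w : WithLp 2 (L2 Ω × L2Vec Ω) | ∃ φ : E n → ℝ,
      IsTest Ω φ ∧ w.fst =ᵐ[volume.restrict Ω] φ ∧
      w.snd =ᵐ[volume.restrict Ω] fun x => gradient φ x}) :
    eLpNorm w.fst m (volume.restrict Ω) ≤ S * ‖w‖ₑ := by
  obtain ⟨φ, hφ, h1, h2⟩ := exists_isTest_of_mem_span hw
  have e2 : eLpNorm (fderiv ℝ φ) 2 volume = ‖w.snd‖ₑ := by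
    rw [Lp.enorm_def, eLpNorm_congr_ae h2, ← hφ.eLpNorm_fderiv_restrict]
    refine eLpNorm_congr_norm_ae (Eventually.of_forall fun x => ?_)
    simp [gradient]
  rw [eLpNorm_congr_ae h1, eLpNorm_restrict_eq_of_support_subset hφ.support_subset]
  refine (hS φ hφ).trans ?_
  rw [e2]
  gcongr
  exact enorm_snd_le w

/-- Convergence in `L²` gives an almost everywhere convergent subsequence, and Fatou's lemma makes
the `L^m` norm lower semicontinuous along it. Membership of the limit in `L^m` is thus a conclusion.
-/
lemma eLpNorm_le_of_tendsto {m : ℝ≥0} {S : ℝ≥0} {w : ℕ → WithLp 2 (L2 Ω × L2Vec Ω)}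
    {z : WithLp 2 (L2 Ω × L2Vec Ω)} (hlim : Tendsto w atTop (𝓝 z))
    (hw : ∀ k, eLpNorm (w k).fst m (volume.restrict Ω) ≤ S * ‖w k‖ₑ) :
    eLpNorm z.fst m (volume.restrict Ω) ≤ S * ‖z‖ₑ := by
  have hfst : Tendsto (fun k => (w k).fst) atTop (𝓝 z.fst) :=
    ((WithLp.fstL 2 ℝ (L2 Ω) (L2Vec Ω)).continuous.tendsto _).comp hlim
  obtain ⟨ns, hns, hae⟩ := (tendstoInMeasure_of_tendsto_Lp hfst).exists_seq_tendsto_ae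
  have h1 := Lp.eLpNorm_lim_le_liminf_eLpNorm (p := m)
    (fun k => Lp.aestronglyMeasurable (w (ns k)).fst) _ hae
  have h2 : Tendsto (fun k => (S : ℝ≥0∞) * ‖w (ns k)‖ₑ) atTop (𝓝 (S * ‖z‖ₑ)) :=
    ENNReal.Tendsto.const_mul ((hlim.comp hns.tendsto_atTop).enorm) (Or.inr ENNReal.coe_ne_top)
  calc eLpNorm z.fst m (volume.restrict Ω)
      ≤ liminf (fun k => eLpNorm (w (ns k)).fst m (volume.restrict Ω)) atTop := h1
    _ ≤ liminf (fun k => (S : ℝ≥0∞) * ‖w (ns k)‖ₑ) atTop :=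
        liminf_le_liminf (Eventually.of_forall fun k => hw (ns k))
    _ = S * ‖z‖ₑ := h2.liminf_eq

/-- The Sobolev inequality in `H₀¹(Ω)`. -/
lemma exists_sobolev_const (hn : 1 ≤ n) (hΩb : Bornology.IsBounded Ω) {m : ℝ≥0} (hm : 2 ≤ m)
    (hmn : 3 ≤ n → (m : ℝ) ≤ 2 * n / (n - 2)) :
    ∃ S : ℝ≥0, ∀ z : H01 Ω, eLpNorm (val z) m (volume.restrict Ω) ≤ S * ‖z‖ₑ := by
  obtain ⟨S, hS⟩ := exists_sobolev_const_test hn hΩb hm hmn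
  refine ⟨S, fun z => ?_⟩
  obtain ⟨w, hw, hlim⟩ := mem_closure_iff_seq_limit.1 z.2
  exact eLpNorm_le_of_tendsto hlim fun k => eLpNorm_fst_le_of_mem_span hS (hw k)

lemma exists_sobolev_const_ofReal (hn : 1 ≤ n) (hΩb : Bornology.IsBounded Ω) (m : ℝ≥0)
    (hm : 2 ≤ m) (hmn : 3 ≤ n → (m : ℝ) ≤ 2 * n / (n - 2)) :
    ∃ S : ℝ≥0, ∀ z : H01 Ω,
      eLpNorm (val z) m (volume.restrict Ω) ≤ ENNReal.ofReal (S * ‖z‖) := by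
  obtain ⟨S, hS⟩ := exists_sobolev_const hn hΩb hm hmn
  refine ⟨S, fun z => ?_⟩
  rw [ENNReal.ofReal_mul (NNReal.coe_nonneg S), ENNReal.ofReal_coe_nnreal, ofReal_norm]
  exact hS z

end

/-! ### Pointwise estimates for the nonlinearity. -/

section

variable {n : ℕ} {Ω : Set (E n)}

section Powers

lemma abs_rpow_sub_rpow_le {p R x y : ℝ} (hp : 1 ≤ p) (hx : x ∈ Icc 0 R) (hy : y ∈ Icc 0 R) :
    |y ^ p - x ^ p| ≤ p * R ^ (p - 1) * |y - x| := by
  refine Convex.norm_image_sub_le_of_norm_hasDerivWithin_le (f' := fun t => p * t ^ (p - 1))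
    (fun t ht => (Real.hasDerivAt_rpow_const (Or.inr hp)).hasDerivWithinAt) (fun t ht => ?_)
    (convex_Icc 0 R) hx hy
  rw [Real.norm_eq_abs, abs_of_nonneg (mul_nonneg (by linarith) (Real.rpow_nonneg ht.1 _))]
  exact mul_le_mul_of_nonneg_left (Real.rpow_le_rpow ht.1 ht.2 (by linarith)) (by linarith)

lemma rpow_le_one_add_rpow {p P R : ℝ} (hp : 1 ≤ p) (hpP : p ≤ P) (hR : 0 ≤ R) :
    R ^ (p - 1) ≤ (1 + R) ^ (P - 1) :=
  (Real.rpow_le_rpow hR (by linarith) (by linarith)).trans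
    (Real.rpow_le_rpow_of_exponent_le (by linarith) (by linarith))

lemma abs_abs_rpow_sub_le {p P R a b : ℝ} (hp : 1 < p) (hpP : p ≤ P) (ha : |a| ≤ R)
    (hb : |b| ≤ R) : |(|b| ^ p) - |a| ^ p| ≤ 2 * P * (1 + R) ^ (P - 1) * |b - a| := by
  have hR : 0 ≤ R := (abs_nonneg a).trans ha
  have h1 := abs_rpow_sub_rpow_le hp.le ⟨abs_nonneg a, ha⟩ ⟨abs_nonneg b, hb⟩
  have h2 := rpow_le_one_add_rpow hp.le hpP hR
  have h3 : 0 ≤ R ^ (p - 1) := Real.rpow_nonneg hR _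
  calc |(|b| ^ p) - |a| ^ p| ≤ p * R ^ (p - 1) * |b - a| :=
        h1.trans (mul_le_mul_of_nonneg_left (abs_abs_sub_abs_le b a) (by positivity))
    _ ≤ (2 * P) * (1 + R) ^ (P - 1) * |b - a| := by
        gcongr
        · linarith
        · linarith

/-- Splitting into positive and negative parts reduces the signed power to `t^p` on `[0,R]`, where
the mean value inequality applies. -/
lemma abs_rpow_mul_eq {p : ℝ} (hp : 1 < p) (u : ℝ) :
    |u| ^ (p - 1) * u = (max u 0) ^ p - (max (-u) 0) ^ p := by
  have hp0 : p ≠ 0 := by linarith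
  have key : ∀ v : ℝ, 0 ≤ v → v ^ (p - 1) * v = v ^ p := fun v hv => by
    rcases hv.eq_or_lt with h | h
    · rw [← h, mul_zero, Real.zero_rpow hp0]
    · rw [Real.rpow_sub_one h.ne', div_mul_cancel₀ _ h.ne']
  rcases le_total 0 u with h | h
  · rw [abs_of_nonneg h, max_eq_left h, max_eq_right (by linarith), Real.zero_rpow hp0, sub_zero,
      key u h]
  · rw [abs_of_nonpos h, max_eq_right h, max_eq_left (by linarith), Real.zero_rpow hp0, zero_sub,
      ← key (-u) (by linarith)]
    ring

lemma abs_signed_rpow_sub_le {p P R a b : ℝ} (hp : 1 < p) (hpP : p ≤ P) (ha : |a| ≤ R)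
    (hb : |b| ≤ R) :
    |(|b| ^ (p - 1)) * b - |a| ^ (p - 1) * a| ≤ 2 * P * (1 + R) ^ (P - 1) * |b - a| := by
  have hR : 0 ≤ R := (abs_nonneg a).trans ha
  rw [abs_le] at ha hb
  have h1 := abs_rpow_sub_rpow_le (p := p) (R := R) (x := max a 0) (y := max b 0) hp.le
    ⟨le_max_right _ _, max_le ha.2 hR⟩ ⟨le_max_right _ _, max_le hb.2 hR⟩
  have h2 := abs_rpow_sub_rpow_le (p := p) (R := R) (x := max (-a) 0) (y := max (-b) 0) hp.le
    ⟨le_max_right _ _, max_le (by linarith) hR⟩ ⟨le_max_right _ _, max_le (by linarith) hR⟩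
  have h3 := abs_max_sub_max_le_abs b a 0
  have h4 := abs_max_sub_max_le_abs (-b) (-a) 0
  have e : -b - -a = -(b - a) := by ring
  rw [e, abs_neg] at h4
  have h5 := rpow_le_one_add_rpow hp.le hpP hR
  have h6 : 0 ≤ R ^ (p - 1) := Real.rpow_nonneg hR _
  rw [abs_rpow_mul_eq hp, abs_rpow_mul_eq hp]
  have h7 : |max b 0 ^ p - max (-b) 0 ^ p - (max a 0 ^ p - max (-a) 0 ^ p)|
      ≤ |max b 0 ^ p - max a 0 ^ p| + |max (-b) 0 ^ p - max (-a) 0 ^ p| := by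
    refine le_trans (le_of_eq ?_) (abs_sub _ _)
    congr 1
    ring
  calc _ ≤ p * R ^ (p - 1) * |b - a| + p * R ^ (p - 1) * |b - a| :=
        h7.trans (add_le_add
          (h1.trans (mul_le_mul_of_nonneg_left h3 (by positivity)))
          (h2.trans (mul_le_mul_of_nonneg_left h4 (by positivity))))
    _ = 2 * p * R ^ (p - 1) * |b - a| := by ring
    _ ≤ 2 * P * (1 + R) ^ (P - 1) * |b - a| := by
        gcongr
        linarith

lemma hasDerivAt_abs_rpow_div {p : ℝ} (hp : 1 < p) (u : ℝ) :
    HasDerivAt (fun u : ℝ => |u| ^ (p + 1) / (p + 1)) (|u| ^ (p - 1) * u) u := by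
  have h := (hasDerivAt_abs_rpow u (p := p + 1) (by linarith)).div_const (p + 1)
  refine h.congr_deriv ?_
  have : p + 1 - 2 = p - 1 := by ring
  rw [this]
  field_simp

lemma hasDerivAt_abs_rpow_mul_div {p : ℝ} (hp : 1 < p) (u : ℝ) :
    HasDerivAt (fun u : ℝ => |u| ^ p * u / (p + 1)) (|u| ^ p) u := by
  have h := ((hasDerivAt_abs_rpow u hp).mul (hasDerivAt_id u)).div_const (p + 1)
  refine h.congr_deriv ?_
  have : p * |u| ^ (p - 2) * u * id u = p * |u| ^ p := by
    rcases eq_or_ne u 0 with rfl | hu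
    · simp [Real.zero_rpow (by linarith : p ≠ 0)]
    · have h1 : |u| ^ p = |u| ^ (p - 2) * |u| ^ (2 : ℝ) := by
        rw [← Real.rpow_add (abs_pos.2 hu)]; congr 1; ring
      rw [h1, Real.rpow_two, sq_abs, id]
      ring
  rw [this]
  have : p + 1 ≠ 0 := by linarith
  field_simp

lemma mul_abs_rpow_mul_self {p : ℝ} (hp : 1 < p) (u : ℝ) :
    u * (|u| ^ (p - 1) * u) = |u| ^ (p + 1) := by
  rcases eq_or_ne u 0 with rfl | hu
  · simp [Real.zero_rpow (by linarith : p + 1 ≠ 0)]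
  · have h1 : |u| ^ (p + 1) = |u| ^ (p - 1) * |u| ^ (2 : ℝ) := by
      rw [← Real.rpow_add (abs_pos.2 hu)]; congr 1; ring
    rw [h1, Real.rpow_two, sq_abs]
    ring

end Powers

namespace Nonlinearity

/-- The primitive `∫_0^u f(x,w) dw`. -/
def primitive (N : Nonlinearity n) (x : E n) (u : ℝ) : ℝ :=
  (match N.form with
    | Form.F1 => N.a 0 x * (|u| ^ (N.p 0 + 1) / (N.p 0 + 1))
    | Form.F2 => N.a 0 x * (|u| ^ (N.p 0) * u / (N.p 0 + 1)))
  + ∑ i : Fin N.r, N.a i.succ x * (|u| ^ (N.p i.succ + 1) / (N.p i.succ + 1))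
  + ∑ j : Fin N.s, N.b j x * (|u| ^ (N.q j + 1) / (N.q j + 1))

/-- The largest exponent. -/
def pmax (N : Nonlinearity n) : ℝ := N.p (Fin.last N.r)

namespace Admissible

variable {N : Nonlinearity n}

lemma one_lt_p' (hN : N.Admissible Ω) (i : Fin (N.r + 1)) : 1 < N.p i :=
  hN.one_lt_p.trans_le (hN.p_strictMono.monotone (Fin.zero_le i))

lemma p_le_pmax (hN : N.Admissible Ω) (i : Fin (N.r + 1)) : N.p i ≤ N.pmax :=
  hN.p_strictMono.monotone (Fin.le_last i)

lemma q_le_pmax (hN : N.Admissible Ω) (j : Fin N.s) : N.q j ≤ N.pmax :=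
  (hN.q_lt_p j).le.trans (hN.p_le_pmax 0)

lemma one_lt_pmax (hN : N.Admissible Ω) : 1 < N.pmax := hN.one_lt_p' _

lemma hasDerivAt_primitive (hN : N.Admissible Ω) (x : E n) (u : ℝ) :
    HasDerivAt (N.primitive x) (N.f x u) u := by
  unfold primitive f
  refine (HasDerivAt.add ?_ (HasDerivAt.fun_sum fun i _ => ?_)).add
    (HasDerivAt.fun_sum fun j _ => ?_)
  · cases N.form
    · exact (hasDerivAt_abs_rpow_div hN.one_lt_p u).const_mul _
    · exact (hasDerivAt_abs_rpow_mul_div hN.one_lt_p u).const_mul _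
  · exact (hasDerivAt_abs_rpow_div (hN.one_lt_p' _) u).const_mul _
  · exact (hasDerivAt_abs_rpow_div (hN.one_lt_q _) u).const_mul _

lemma f_zero (hN : N.Admissible Ω) (x : E n) : N.f x 0 = 0 := by
  unfold f
  cases N.form <;> simp [Real.zero_rpow (by linarith [hN.one_lt_p] : N.p 0 ≠ 0)]

lemma primitive_zero (hN : N.Admissible Ω) (x : E n) : N.primitive x 0 = 0 := by
  have h1 : ∀ i, N.p i + 1 ≠ 0 := fun i => by linarith [hN.one_lt_p' i]
  have h2 : ∀ j, N.q j + 1 ≠ 0 := fun j => by linarith [hN.one_lt_q j]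
  unfold primitive
  cases N.form <;> simp [Real.zero_rpow, h1, h2]

lemma continuous_f (hN : N.Admissible Ω) (x : E n) : Continuous (N.f x) := by
  have h1 : ∀ i, Continuous fun u : ℝ => |u| ^ (N.p i - 1) * u := fun i =>
    (continuous_abs.rpow_const fun u => Or.inr (by linarith [hN.one_lt_p' i])).mul continuous_id
  have h2 : ∀ j, Continuous fun u : ℝ => |u| ^ (N.q j - 1) * u := fun j =>
    (continuous_abs.rpow_const fun u => Or.inr (by linarith [hN.one_lt_q j])).mul continuous_id
  unfold f
  refine (Continuous.add ?_ (continuous_finsetSum _ fun i _ => ?_)).add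
    (continuous_finsetSum _ fun j _ => ?_)
  · cases N.form
    · exact (h1 0).const_mul _
    · exact (continuous_abs.rpow_const fun u => Or.inr (by linarith [hN.one_lt_p])).const_mul _
  · exact (h1 _).const_mul _
  · exact (h2 _).const_mul _

lemma integral_f (hN : N.Admissible Ω) (x : E n) (u : ℝ) :
    ∫ w in (0 : ℝ)..u, N.f x w = N.primitive x u := by
  rw [intervalIntegral.integral_eq_sub_of_hasDerivAt (fun w _ => hN.hasDerivAt_primitive x w)
    ((hN.continuous_f x).intervalIntegrable _ _), hN.primitive_zero, sub_zero]

/-- The `a₁` term gives equality, whatever its sign. For the other `aᵢ ≥ 0` the ratio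
`(p₁+1)/(pᵢ+1)` is at most one. For `bⱼ ≤ 0` the ratio `(p₁+1)/(qⱼ+1)` is at least one, and the sign
reverses the inequality. -/
lemma primitive_le (hN : N.Admissible Ω) {x : E n} (hx : x ∈ Ω) (u : ℝ) :
    (N.p 0 + 1) * N.primitive x u ≤ u * N.f x u := by
  have hx' := subset_closure hx
  have hp := hN.one_lt_p
  unfold primitive f
  rw [mul_add, mul_add, mul_add, mul_add, Finset.mul_sum, Finset.mul_sum, Finset.mul_sum,
    Finset.mul_sum]
  refine add_le_add (add_le_add ?_ (Finset.sum_le_sum fun i _ => ?_))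
    (Finset.sum_le_sum fun j _ => ?_)
  · have h1 : N.p 0 + 1 ≠ 0 := by linarith
    cases N.form
    · simp only
      rw [mul_left_comm u, mul_abs_rpow_mul_self hp]
      apply le_of_eq
      field_simp
    · apply le_of_eq
      simp only
      field_simp
  · have h1 := hN.one_lt_p' i.succ
    rw [mul_left_comm u, mul_abs_rpow_mul_self h1, mul_left_comm]
    refine mul_le_mul_of_nonneg_left ?_ (hN.a_nonneg _ (Fin.succ_ne_zero i) x hx')
    rw [mul_div_left_comm]
    refine mul_le_of_le_one_right (Real.rpow_nonneg (abs_nonneg u) _) ?_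
    rw [div_le_one (by linarith)]
    linarith [hN.p_strictMono.monotone (Fin.zero_le i.succ)]
  · have h1 := hN.one_lt_q j
    rw [mul_left_comm u, mul_abs_rpow_mul_self h1, mul_left_comm]
    refine mul_le_mul_of_nonpos_left ?_ (hN.b_nonpos j x hx')
    rw [mul_div_left_comm]
    refine le_mul_of_one_le_right (Real.rpow_nonneg (abs_nonneg u) _) ?_
    rw [one_le_div (by linarith)]
    linarith [hN.q_lt_p j]

lemma exists_abs_f_sub_le (hN : N.Admissible Ω) (hΩb : Bornology.IsBounded Ω) :
    ∃ M : ℝ, 0 ≤ M ∧ ∀ x ∈ Ω, ∀ R a b : ℝ, |a| ≤ R → |b| ≤ R →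
      |N.f x b - N.f x a| ≤ M * (1 + R) ^ (N.pmax - 1) * |b - a| := by
  have hK : IsCompact (closure Ω) := hΩb.isCompact_closure
  choose A hA using fun i => hK.exists_bound_of_continuousOn (hN.a_continuous i)
  choose B hB using fun j => hK.exists_bound_of_continuousOn (hN.b_continuous j)
  have hpm := hN.one_lt_pmax
  refine ⟨(|A 0| + ∑ i : Fin N.r, |A i.succ| + ∑ j, |B j|) * (2 * N.pmax), by positivity,
    fun x hx R a b ha hb => ?_⟩
  have hx' := subset_closure hx
  set W := 2 * N.pmax * (1 + R) ^ (N.pmax - 1) * |b - a| with hW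
  have hterm : ∀ c C h₁ h₂ : ℝ, |c| ≤ C → |h₂ - h₁| ≤ W → |c * h₂ - c * h₁| ≤ |C| * W := by
    intro c C h₁ h₂ hc hh
    rw [← mul_sub, abs_mul]
    exact mul_le_mul (hc.trans (le_abs_self C)) hh (abs_nonneg _) (abs_nonneg _)
  have hgoal : (|A 0| + ∑ i : Fin N.r, |A i.succ| + ∑ j, |B j|) * (2 * N.pmax) *
      (1 + R) ^ (N.pmax - 1) * |b - a|
      = |A 0| * W + ∑ i : Fin N.r, |A i.succ| * W + ∑ j, |B j| * W := by
    rw [hW, ← Finset.sum_mul, ← Finset.sum_mul]; ring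
  rw [hgoal]
  unfold f
  have hsplit : ∀ x₁ x₂ x₃ y₁ y₂ y₃ : ℝ, |x₁ + x₂ + x₃ - (y₁ + y₂ + y₃)|
      ≤ |x₁ - y₁| + |x₂ - y₂| + |x₃ - y₃| := by
    intro x₁ x₂ x₃ y₁ y₂ y₃
    have : x₁ + x₂ + x₃ - (y₁ + y₂ + y₃) = (x₁ - y₁) + (x₂ - y₂) + (x₃ - y₃) := by ring
    rw [this]
    exact abs_add_three _ _ _
  refine (hsplit _ _ _ _ _ _).trans (add_le_add (add_le_add ?_ ?_) ?_)
  · cases N.form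
    · exact hterm _ _ _ _ (hA 0 x hx') (abs_signed_rpow_sub_le hN.one_lt_p (hN.p_le_pmax 0) ha hb)
    · exact hterm _ _ _ _ (hA 0 x hx') (abs_abs_rpow_sub_le hN.one_lt_p (hN.p_le_pmax 0) ha hb)
  · rw [← Finset.sum_sub_distrib]
    exact (Finset.abs_sum_le_sum_abs _ _).trans (Finset.sum_le_sum fun i _ =>
      hterm _ _ _ _ (hA _ x hx') (abs_signed_rpow_sub_le (hN.one_lt_p' _) (hN.p_le_pmax _) ha hb))
  · rw [← Finset.sum_sub_distrib]
    exact (Finset.abs_sum_le_sum_abs _ _).trans (Finset.sum_le_sum fun j _ =>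
      hterm _ _ _ _ (hB _ x hx') (abs_signed_rpow_sub_le (hN.one_lt_q _) (hN.q_le_pmax _) ha hb))

/-- Between `a` and `b`, the function `w ↦ F(x,w) - f(x,a)w` has derivative `f(x,w) - f(x,a)`, which
the Lipschitz bound controls by `|b - a|`. -/
lemma abs_primitive_sub_le (hN : N.Admissible Ω) {M : ℝ} {x : E n}
    (hM0 : 0 ≤ M) (hM : ∀ R a b : ℝ, |a| ≤ R → |b| ≤ R →
      |N.f x b - N.f x a| ≤ M * (1 + R) ^ (N.pmax - 1) * |b - a|) {R a b : ℝ}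
    (ha : |a| ≤ R) (hb : |b| ≤ R) :
    |N.primitive x b - N.primitive x a - N.f x a * (b - a)|
      ≤ M * (1 + R) ^ (N.pmax - 1) * |b - a| * |b - a| := by
  have hR : 0 ≤ R := (abs_nonneg a).trans ha
  have h := Convex.norm_image_sub_le_of_norm_hasDerivWithin_le
    (f := fun w => N.primitive x w - N.f x a * w) (f' := fun w => N.f x w - N.f x a * 1)
    (C := M * (1 + R) ^ (N.pmax - 1) * |b - a|) (s := uIcc a b) (x := a) (y := b)
    (fun w _ => ((hN.hasDerivAt_primitive x w).sub
      ((hasDerivAt_id w).const_mul _)).hasDerivWithinAt) (fun w hw => ?_)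
    (convex_uIcc a b) left_mem_uIcc right_mem_uIcc
  · refine le_trans (le_of_eq ?_) h
    rw [Real.norm_eq_abs]
    congr 1
    ring
  · rw [mul_one]
    have hw' : |w| ≤ R := by
      rw [abs_le] at ha hb ⊢
      exact ⟨(le_min ha.1 hb.1).trans hw.1, hw.2.trans (max_le ha.2 hb.2)⟩
    refine (hM R a w ha hw').trans (mul_le_mul_of_nonneg_left ?_ (by positivity))
    exact abs_sub_left_of_mem_uIcc hw

variable {u : E n → ℝ}

lemma aestronglyMeasurable_f (hN : N.Admissible Ω) (hΩ : IsOpen Ω)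
    (hu : AEStronglyMeasurable u (volume.restrict Ω)) :
    AEStronglyMeasurable (fun x => N.f x (u x)) (volume.restrict Ω) := by
  have ha : ∀ i, AEMeasurable (N.a i) (volume.restrict Ω) := fun i =>
    ((hN.a_continuous i).mono subset_closure).aemeasurable hΩ.measurableSet
  have hb : ∀ j, AEMeasurable (N.b j) (volume.restrict Ω) := fun j =>
    ((hN.b_continuous j).mono subset_closure).aemeasurable hΩ.measurableSet
  have hpow : ∀ p : ℝ, AEMeasurable (fun x => |u x| ^ p) (volume.restrict Ω) := fun p =>
    (measurable_abs.comp_aemeasurable hu.aemeasurable).pow_const p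
  refine AEMeasurable.aestronglyMeasurable ?_
  unfold f
  refine (AEMeasurable.add ?_ (Finset.aemeasurable_fun_sum _ fun i _ => ?_)).add
    (Finset.aemeasurable_fun_sum _ fun j _ => ?_)
  · cases N.form
    · exact (ha 0).mul ((hpow _).mul hu.aemeasurable)
    · exact (ha 0).mul (hpow _)
  · exact (ha _).mul ((hpow _).mul hu.aemeasurable)
  · exact (hb _).mul ((hpow _).mul hu.aemeasurable)

lemma aestronglyMeasurable_primitive (hN : N.Admissible Ω) (hΩ : IsOpen Ω)
    (hu : AEStronglyMeasurable u (volume.restrict Ω)) :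
    AEStronglyMeasurable (fun x => N.primitive x (u x)) (volume.restrict Ω) := by
  have ha : ∀ i, AEMeasurable (N.a i) (volume.restrict Ω) := fun i =>
    ((hN.a_continuous i).mono subset_closure).aemeasurable hΩ.measurableSet
  have hb : ∀ j, AEMeasurable (N.b j) (volume.restrict Ω) := fun j =>
    ((hN.b_continuous j).mono subset_closure).aemeasurable hΩ.measurableSet
  have hpow : ∀ p : ℝ, AEMeasurable (fun x => |u x| ^ p) (volume.restrict Ω) := fun p =>
    (measurable_abs.comp_aemeasurable hu.aemeasurable).pow_const p
  refine AEMeasurable.aestronglyMeasurable ?_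
  unfold primitive
  refine (AEMeasurable.add ?_ (Finset.aemeasurable_fun_sum _ fun i _ => ?_)).add
    (Finset.aemeasurable_fun_sum _ fun j _ => ?_)
  · cases N.form
    · exact (ha 0).mul ((hpow _).div_const _)
    · exact (ha 0).mul (((hpow _).mul hu.aemeasurable).div_const _)
  · exact (ha _).mul ((hpow _).div_const _)
  · exact (hb _).mul ((hpow _).div_const _)

end Admissible

end Nonlinearity

end

/-! ### The nonlinearity as a map between function spaces. -/

section

variable {n : ℕ} {Ω : Set (E n)} {N : Nonlinearity n}
  {H : Type*} [NormedAddCommGroup H]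

/-- The bound for the norm of `weight`. -/
def growth (N : Nonlinearity n) (B : ℝ) (a b : H) : ℝ :=
  B * (1 + ‖a‖ + ‖b‖) ^ (N.pmax - 1) * ‖b - a‖

lemma growth_nonneg {B : ℝ} (hB : 0 ≤ B) (a b : H) : 0 ≤ growth N B a b := by
  unfold growth; positivity

lemma tendsto_growth (hN : N.Admissible Ω) (B : ℝ) (a : H) :
    Tendsto (growth N B a) (𝓝 a) (𝓝 0) := by
  have hc : Continuous (growth N B a) := by
    unfold growth
    refine (continuous_const.mul (Continuous.rpow_const (by fun_prop) fun b => Or.inr ?_)).mul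
      (by fun_prop)
    linarith [hN.one_lt_pmax]
  have := hc.tendsto a
  rwa [show growth N B a a = 0 by simp [growth]] at this

variable [NormedSpace ℝ H] {j : H →L[ℝ] L2 Ω}

/-- The weight `(1 + |a| + |b|)^{P-1} |b - a|`, which controls `f(·,b) - f(·,a)`. -/
def weight (N : Nonlinearity n) (j : H →L[ℝ] L2 Ω) (a b : H) (x : E n) : ℝ :=
  (1 + |j a x| + |j b x|) ^ (N.pmax - 1) * |j b x - j a x|

lemma weight_nonneg (a b : H) (x : E n) : 0 ≤ weight N j a b x := by
  unfold weight; positivity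

lemma aestronglyMeasurable_coe (j : H →L[ℝ] L2 Ω) (z : H) :
    AEStronglyMeasurable (j z) (volume.restrict Ω) :=
  Lp.aestronglyMeasurable _

lemma aestronglyMeasurable_weight (a b : H) :
    AEStronglyMeasurable (weight N j a b) (volume.restrict Ω) := by
  have ha := (aestronglyMeasurable_coe j a).aemeasurable
  have hb := (aestronglyMeasurable_coe j b).aemeasurable
  refine AEMeasurable.aestronglyMeasurable ?_
  exact (((measurable_abs.comp_aemeasurable ha).const_add 1).add
    (measurable_abs.comp_aemeasurable hb)).pow_const _ |>.mul
    (measurable_abs.comp_aemeasurable (hb.sub ha))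

lemma eLpNorm_coe_sub (a b : H) (p : ℝ≥0∞) :
    eLpNorm (fun x => j b x - j a x) p (volume.restrict Ω)
      = eLpNorm (j (b - a)) p (volume.restrict Ω) := by
  refine eLpNorm_congr_ae ?_
  rw [map_sub]
  exact (Lp.coeFn_sub _ _).symm

/-- Hölder's inequality with real exponents `m / (P - 1)`, `m` and `m / P`. -/
lemma holderTriple_ofReal {m : ℝ≥0} {P : ℝ} (hP : 1 < P) (hm : 0 < m) :
    ENNReal.HolderTriple (ENNReal.ofReal (m / (P - 1))) m (ENNReal.ofReal (m / P)) := by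
  have hm' : (0 : ℝ) < m := hm
  refine ⟨?_⟩
  rw [← ENNReal.ofReal_coe_nnreal (p := m), ← ENNReal.ofReal_inv_of_pos (by positivity),
    ← ENNReal.ofReal_inv_of_pos (div_pos hm' (by linarith)),
    ← ENNReal.ofReal_inv_of_pos (by positivity), ← ENNReal.ofReal_add]
  · congr 1
    field_simp
    ring
  · exact inv_nonneg.2 (div_pos hm' (by linarith)).le
  · positivity

/-- Hölder: the factor `(1+|a|+|b|)^(P-1)` is measured in `L^(m/(P-1))`, where its norm is the `L^m`
norm of the base to the power `P-1`, and `|b-a|` in `L^m`. -/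
lemma exists_eLpNorm_weight_le (hN : N.Admissible Ω) (hΩb : Bornology.IsBounded Ω) {m S : ℝ≥0}
    (hm : 1 ≤ m)
    (hS : ∀ z : H, eLpNorm (j z) m (volume.restrict Ω) ≤ ENNReal.ofReal (S * ‖z‖)) :
    ∃ B : ℝ, 0 ≤ B ∧ ∀ a b : H,
      eLpNorm (weight N j a b) (ENNReal.ofReal (m / N.pmax)) (volume.restrict Ω)
        ≤ ENNReal.ofReal (growth N B a b) := by
  have : IsFiniteMeasure (volume.restrict Ω) := ⟨by simpa using hΩb.measure_lt_top⟩
  have hP := hN.one_lt_pmax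
  have hP1 : 0 < N.pmax - 1 := by linarith
  have hm0 : 0 < m := zero_lt_one.trans_le hm
  set K := (eLpNorm (fun _ : E n => (1 : ℝ)) m (volume.restrict Ω)).toReal with hK
  have hKt : eLpNorm (fun _ : E n => (1 : ℝ)) m (volume.restrict Ω) = ENNReal.ofReal K :=
    (ENNReal.ofReal_toReal (memLp_const (1 : ℝ)).2.ne).symm
  have hK0 : 0 ≤ K := ENNReal.toReal_nonneg
  refine ⟨(K + S) ^ (N.pmax - 1) * S, by positivity, fun a b => ?_⟩
  set θ : E n → ℝ := fun x => 1 + |j a x| + |j b x| with hθ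
  have haM := (aestronglyMeasurable_coe j a).norm
  have hbM := (aestronglyMeasurable_coe j b).norm
  have hcM : AEStronglyMeasurable (fun _ : E n => (1 : ℝ)) (volume.restrict Ω) :=
    aestronglyMeasurable_const
  have hθM : AEStronglyMeasurable θ (volume.restrict Ω) := (hcM.add haM).add hbM
  have hθn : eLpNorm θ m (volume.restrict Ω)
      ≤ ENNReal.ofReal ((K + S) * (1 + ‖a‖ + ‖b‖)) := by
    have hm1 : (1 : ℝ≥0∞) ≤ m := by exact_mod_cast hm
    have h1 := eLpNorm_add_le (hcM.add haM) hbM hm1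
    have h2 := eLpNorm_add_le hcM haM hm1
    rw [eLpNorm_norm] at h1 h2
    have h3 : eLpNorm θ m (volume.restrict Ω) ≤
        ENNReal.ofReal K + ENNReal.ofReal (S * ‖a‖) + ENNReal.ofReal (S * ‖b‖) :=
      h1.trans (add_le_add (h2.trans (add_le_add hKt.le (hS a))) (hS b))
    refine h3.trans ?_
    rw [← ENNReal.ofReal_add (by positivity) (by positivity),
      ← ENNReal.ofReal_add (by positivity) (by positivity)]
    refine ENNReal.ofReal_le_ofReal ?_
    have := mul_nonneg hK0 (norm_nonneg a)
    have := mul_nonneg hK0 (norm_nonneg b)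
    have := S.2
    nlinarith
  have hpow : eLpNorm (fun x => θ x ^ (N.pmax - 1)) (ENNReal.ofReal (m / (N.pmax - 1)))
      (volume.restrict Ω) = eLpNorm θ m (volume.restrict Ω) ^ (N.pmax - 1) := by
    have h1 := eLpNorm_norm_rpow (p := ENNReal.ofReal (m / (N.pmax - 1)))
      (μ := volume.restrict Ω) θ hP1
    have h2 : ENNReal.ofReal (m / (N.pmax - 1)) * ENNReal.ofReal (N.pmax - 1) = m := by
      rw [← ENNReal.ofReal_mul (div_nonneg (NNReal.coe_nonneg m) hP1.le), div_mul_cancel₀ _ hP1.ne',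
        ENNReal.ofReal_coe_nnreal]
    rw [h2] at h1
    rw [← h1]
    congr 1
    ext x
    rw [Real.norm_of_nonneg]
    positivity
  have := holderTriple_ofReal hP hm0
  have hmain := eLpNorm_smul_le_mul_eLpNorm (μ := volume.restrict Ω)
    (p := ENNReal.ofReal (m / (N.pmax - 1))) (q := m) (r := ENNReal.ofReal (m / N.pmax))
    (f := fun x => |j b x - j a x|) (φ := fun x => θ x ^ (N.pmax - 1))
    ((aestronglyMeasurable_coe j b).sub (aestronglyMeasurable_coe j a)).norm
    (hθM.aemeasurable.pow_const _).aestronglyMeasurable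
  have habs : eLpNorm (fun x => |j b x - j a x|) m (volume.restrict Ω)
      = eLpNorm (fun x => j b x - j a x) m (volume.restrict Ω) :=
    eLpNorm_norm (fun x => j b x - j a x)
  rw [hpow, habs, eLpNorm_coe_sub] at hmain
  refine hmain.trans ?_
  have h4 : growth N ((K + S) ^ (N.pmax - 1) * S) a b
      = ((K + S) * (1 + ‖a‖ + ‖b‖)) ^ (N.pmax - 1) * (S * ‖b - a‖) := by
    unfold growth
    rw [Real.mul_rpow (by positivity) (by positivity)]
    ring
  rw [h4, ENNReal.ofReal_mul (by positivity), ← ENNReal.ofReal_rpow_of_nonneg (by positivity) hP1.le]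
  exact mul_le_mul' (ENNReal.rpow_le_rpow hθn hP1.le) (hS _)

lemma memLp_weight {p : ℝ≥0∞} {C : ℝ} {a b : H}
    (h : eLpNorm (weight N j a b) p (volume.restrict Ω) ≤ ENNReal.ofReal C) :
    MemLp (weight N j a b) p (volume.restrict Ω) :=
  ⟨aestronglyMeasurable_weight a b, h.trans_lt ENNReal.ofReal_lt_top⟩

lemma exists_pointwise_bound (j : H →L[ℝ] L2 Ω) (hN : N.Admissible Ω) (hΩb : Bornology.IsBounded Ω) :
    ∃ M : ℝ, 0 ≤ M ∧ ∀ a b : H, ∀ x ∈ Ω,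
      |N.f x (j b x) - N.f x (j a x)| ≤ M * weight N j a b x ∧
      |N.primitive x (j b x) - N.primitive x (j a x)
        - N.f x (j a x) * (j b x - j a x)| ≤ M * (weight N j a b x * |j b x - j a x|) := by
  obtain ⟨M, hM0, hM⟩ := hN.exists_abs_f_sub_le hΩb
  refine ⟨M, hM0, fun a b x hx => ?_⟩
  have ha : |j a x| ≤ |j a x| + |j b x| := le_add_of_nonneg_right (abs_nonneg _)
  have hb : |j b x| ≤ |j a x| + |j b x| := le_add_of_nonneg_left (abs_nonneg _)
  have h1 := hM x hx _ _ _ ha hb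
  have h2 := hN.abs_primitive_sub_le hM0 (hM x hx) ha hb
  rw [← add_assoc] at h1 h2
  refine ⟨h1.trans (le_of_eq ?_), h2.trans (le_of_eq ?_)⟩ <;> (unfold weight; ring)

lemma ae_coe_zero (j : H →L[ℝ] L2 Ω) : ∀ᵐ x ∂(volume.restrict Ω), j (0 : H) x = 0 := by
  rw [map_zero]
  exact Lp.coeFn_zero _ _ _

lemma lintegral_weight_mul_le {p q : ℝ≥0∞} (hpq : ENNReal.HolderTriple p q 1) {C D : ℝ}
    (hC : 0 ≤ C) {a b : H} {η : E n → ℝ}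
    (h : eLpNorm (weight N j a b) p (volume.restrict Ω) ≤ ENNReal.ofReal C)
    (hη : AEStronglyMeasurable η (volume.restrict Ω))
    (hηD : eLpNorm η q (volume.restrict Ω) ≤ ENNReal.ofReal D) :
    Integrable (fun x => weight N j a b x * |η x|) (volume.restrict Ω) ∧
      ∫ x in Ω, weight N j a b x * |η x| ≤ C * max D 0 := by
  have h1 := eLpNorm_smul_le_mul_eLpNorm (μ := volume.restrict Ω) (p := p) (q := q) (r := 1)
    (f := fun x => |η x|) (φ := weight N j a b) hη.norm (aestronglyMeasurable_weight a b)
  have e : eLpNorm (fun x => |η x|) q (volume.restrict Ω) = eLpNorm η q (volume.restrict Ω) :=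
    eLpNorm_norm η
  rw [e] at h1
  have h2 : eLpNorm (fun x => weight N j a b x * |η x|) 1 (volume.restrict Ω)
      ≤ ENNReal.ofReal (C * max D 0) := by
    refine h1.trans ((mul_le_mul' h hηD).trans ?_)
    rw [ENNReal.ofReal_mul hC]
    gcongr
    exact le_max_left _ _
  have hint : Integrable (fun x => weight N j a b x * |η x|) (volume.restrict Ω) :=
    memLp_one_iff_integrable.1
      ⟨(aestronglyMeasurable_weight a b).mul hη.norm, h2.trans_lt ENNReal.ofReal_lt_top⟩
  refine ⟨hint, ?_⟩
  rw [integral_eq_lintegral_of_nonneg_ae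
    (Eventually.of_forall fun x => mul_nonneg (weight_nonneg a b x) (abs_nonneg _)) hint.1]
  refine ENNReal.toReal_le_of_le_ofReal (by positivity) (le_trans (le_of_eq ?_) h2)
  rw [eLpNorm_one_eq_lintegral_enorm]
  refine lintegral_congr fun x => ?_
  rw [Real.enorm_of_nonneg (mul_nonneg (weight_nonneg a b x) (abs_nonneg _))]

/-- Integrability and continuity of the nonlinear functionals in the subcritical range. -/
lemma exists_dual_bound (hN : N.Admissible Ω) (hΩ : IsOpen Ω)
    (hΩb : Bornology.IsBounded Ω)
    (hS : ∀ m : ℝ≥0, 2 ≤ m → (3 ≤ n → (m : ℝ) ≤ 2 * n / (n - 2)) → ∃ S : ℝ≥0, ∀ z : H,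
      eLpNorm (j z) m (volume.restrict Ω) ≤ ENNReal.ofReal (S * ‖z‖)) :
    (∀ z : H, Integrable (fun x => N.primitive x (j z x)) (volume.restrict Ω)) ∧
    (∀ z η : H, Integrable (fun x => N.f x (j z x) * j η x) (volume.restrict Ω)) ∧
    (∀ η : H, Continuous fun z : H => ∫ x in Ω, N.f x (j z x) * j η x) ∧
    (∀ z : H, (N.p 0 + 1) * ∫ x in Ω, N.primitive x (j z x)
      ≤ ∫ x in Ω, N.f x (j z x) * j z x) := by
  have hP := hN.one_lt_pmax
  -- With `m = P+1` the weight lies in `L^((P+1)/P)`, the dual of `L^m`. The Sobolev range `m ≤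
  -- 2n/(n-2)` is `P ≤ (n+2)/(n-2)`.
  set m : ℝ≥0 := ⟨N.pmax + 1, by linarith⟩ with hm
  have hmc : (m : ℝ) = N.pmax + 1 := rfl
  have hm2 : 2 ≤ m := by
    rw [← NNReal.coe_le_coe, hmc]; push_cast; linarith
  obtain ⟨S, hSm⟩ := hS m hm2 (fun h3 => by
    have h3' : (3 : ℝ) ≤ n := by exact_mod_cast h3
    have h4 := hN.p_subcritical h3
    change N.pmax < _ at h4
    rw [hmc, le_div_iff₀ (by linarith)]
    rw [lt_div_iff₀ (by linarith)] at h4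
    linarith)
  obtain ⟨B, hB, hw⟩ := exists_eLpNorm_weight_le hN hΩb (one_le_two.trans hm2) hSm
  obtain ⟨M, hM, hpt⟩ := exists_pointwise_bound j hN hΩb
  have hpq : ENNReal.HolderTriple (ENNReal.ofReal (m / N.pmax)) m 1 := by
    refine ⟨?_⟩
    rw [← ENNReal.ofReal_coe_nnreal (p := m), ← ENNReal.ofReal_inv_of_pos (by positivity),
      ← ENNReal.ofReal_inv_of_pos (by positivity), ← ENNReal.ofReal_add (by positivity)
      (by positivity), inv_one, ENNReal.ofReal_eq_one, hmc]
    field_simp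
  have hkey : ∀ a b η : H,
      Integrable (fun x => weight N j a b x * |j η x|) (volume.restrict Ω) ∧
      ∫ x in Ω, weight N j a b x * |j η x| ≤ growth N B a b * (S * ‖η‖) := fun a b η => by
    have h := lintegral_weight_mul_le hpq (growth_nonneg hB a b) (hw a b)
      (aestronglyMeasurable_coe j η) (hSm η)
    rwa [max_eq_left (by positivity)] at h
  have hfM : ∀ z : H, AEStronglyMeasurable (fun x => N.f x (j z x)) (volume.restrict Ω) :=
    fun z => hN.aestronglyMeasurable_f hΩ (aestronglyMeasurable_coe j z)
  have hae : ∀ᵐ x ∂(volume.restrict Ω), x ∈ Ω := ae_restrict_mem hΩ.measurableSet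
  have hint : ∀ z η : H,
      Integrable (fun x => N.f x (j z x) * j η x) (volume.restrict Ω) := by
    intro z η
    -- As `f(x,0) = 0`, comparison with the zero function turns the difference bound into a growth
    -- bound.
    refine ((hkey 0 z η).1.const_mul M).mono' ((hfM z).mul (aestronglyMeasurable_coe j η)) ?_
    filter_upwards [hae, ae_coe_zero j] with x hx h0
    have := (hpt 0 z x hx).1
    rw [h0, hN.f_zero, sub_zero] at this
    rw [norm_mul, ← mul_assoc]
    exact mul_le_mul_of_nonneg_right this (norm_nonneg _)
  have hprim : ∀ z : H,
      Integrable (fun x => N.primitive x (j z x)) (volume.restrict Ω) := by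
    intro z
    refine ((hkey 0 z z).1.const_mul M).mono'
      (hN.aestronglyMeasurable_primitive hΩ (aestronglyMeasurable_coe j z)) ?_
    filter_upwards [hae, ae_coe_zero j] with x hx h0
    have := (hpt 0 z x hx).2
    rwa [h0, hN.f_zero, hN.primitive_zero, sub_zero, zero_mul, sub_zero, sub_zero] at this
  refine ⟨hprim, hint, fun η => ?_, fun z => ?_⟩
  · refine continuous_iff_continuousAt.2 fun a => ?_
    refine tendsto_iff_norm_sub_tendsto_zero.2 ?_
    have h0 : Tendsto (fun b => M * (growth N B a b * (S * ‖η‖))) (𝓝 a) (𝓝 0) := by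
      simpa using ((tendsto_growth hN B a).mul_const (S * ‖η‖)).const_mul M
    refine squeeze_zero (fun _ => norm_nonneg _) (fun b => ?_) h0
    rw [← integral_sub (hint b η) (hint a η)]
    have h1 : ‖∫ x in Ω, (N.f x (j b x) * j η x - N.f x (j a x) * j η x)‖ ≤
        ∫ x in Ω, M * (weight N j a b x * |j η x|) := by
      refine norm_integral_le_of_norm_le ((hkey a b η).1.const_mul M) ?_
      filter_upwards [hae] with x hx
      rw [← sub_mul, norm_mul, ← mul_assoc]
      exact mul_le_mul_of_nonneg_right (hpt a b x hx).1 (norm_nonneg _)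
    refine h1.trans ?_
    rw [integral_const_mul]
    exact mul_le_mul_of_nonneg_left (hkey a b η).2 hM
  · rw [← integral_const_mul]
    refine integral_mono_ae ((hprim z).const_mul _) (hint z z) ?_
    filter_upwards [hae] with x hx
    rw [mul_comm (N.f x _)]
    exact hN.primitive_le hx _

/-- When `f(·,z) ∈ L²(Ω)` for `z ∈ H₀¹(Ω)`, the potential energy is differentiable. -/
lemma exists_potential_gradient (hN : N.Admissible Ω) (hΩ : IsOpen Ω)
    (hΩb : Bornology.IsBounded Ω)
    (hS : ∀ m : ℝ≥0, 2 ≤ m → (3 ≤ n → (m : ℝ) ≤ 2 * n / (n - 2)) → ∃ S : ℝ≥0, ∀ z : H,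
      eLpNorm (j z) m (volume.restrict Ω) ≤ ENNReal.ofReal (S * ‖z‖))
    (hsub : 3 ≤ n → N.pmax < (n : ℝ) / ((n : ℝ) - 2)) :
    ∃ (Γ : H → L2 Ω) (R : H → H → ℝ), Continuous Γ ∧
      (∀ z η : H, inner ℝ (Γ z) (j η) = ∫ x in Ω, N.f x (j z x) * j η x) ∧
      (∀ a, Tendsto (R a) (𝓝 a) (𝓝 0)) ∧
      ∀ a b : H, |(∫ x in Ω, N.primitive x (j b x)) - (∫ x in Ω, N.primitive x (j a x))
        - inner ℝ (Γ a) (j b - j a)| ≤ R a b * ‖j b - j a‖ := by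
  have hP := hN.one_lt_pmax
  -- With `m = 2P` the weight lies in `L²`. The Sobolev range is now `P ≤ n/(n-2)`, which explains
  -- the threshold for energy conservation.
  set m : ℝ≥0 := ⟨2 * N.pmax, by linarith⟩ with hm
  have hmc : (m : ℝ) = 2 * N.pmax := rfl
  have hm2 : 2 ≤ m := by
    rw [← NNReal.coe_le_coe, hmc]; push_cast; linarith
  obtain ⟨S, hSm⟩ := hS m hm2 (fun h3 => by
    have h4 := hsub h3
    rw [hmc, mul_div_assoc]
    linarith)
  obtain ⟨B, hB, hw⟩ := exists_eLpNorm_weight_le hN hΩb (one_le_two.trans hm2) hSm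
  obtain ⟨M, hM, hpt⟩ := exists_pointwise_bound j hN hΩb
  obtain ⟨hprim, hint, -, -⟩ := exists_dual_bound hN hΩ hΩb hS
  have hm22 : ENNReal.ofReal (m / N.pmax) = 2 := by
    rw [hmc, mul_div_cancel_right₀ _ (by linarith)]; simp
  rw [hm22] at hw
  have hfM : ∀ z : H, AEStronglyMeasurable (fun x => N.f x (j z x)) (volume.restrict Ω) :=
    fun z => hN.aestronglyMeasurable_f hΩ (aestronglyMeasurable_coe j z)
  have hae : ∀ᵐ x ∂(volume.restrict Ω), x ∈ Ω := ae_restrict_mem hΩ.measurableSet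
  have hmem : ∀ z : H, MemLp (fun x => N.f x (j z x)) 2 (volume.restrict Ω) := by
    intro z
    refine (memLp_weight (hw 0 z)).of_le_mul (c := M) (hfM z) ?_
    filter_upwards [hae, ae_coe_zero j] with x hx h0
    have := (hpt 0 z x hx).1
    rw [h0, hN.f_zero, sub_zero] at this
    rwa [Real.norm_eq_abs, Real.norm_of_nonneg (weight_nonneg _ _ _)]
  have hinner : ∀ (z : H) (g : L2 Ω), inner ℝ ((hmem z).toLp _) g
      = ∫ x in Ω, N.f x (j z x) * g x := by
    intro z g
    rw [L2.inner_def]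
    refine integral_congr_ae ?_
    filter_upwards [(hmem z).coeFn_toLp] with x hx
    rw [hx]
    simp [mul_comm]
  refine ⟨fun z => (hmem z).toLp _, fun a b => M * growth N B a b, ?_,
    fun z η => hinner z (j η), fun a => ?_, fun a b => ?_⟩
  · refine continuous_iff_continuousAt.2 fun a => ?_
    refine tendsto_iff_norm_sub_tendsto_zero.2 ?_
    have h0 : Tendsto (fun b => M * growth N B a b) (𝓝 a) (𝓝 0) := by
      simpa using (tendsto_growth hN B a).const_mul M
    refine squeeze_zero (fun _ => norm_nonneg _) (fun b => ?_) h0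
    rw [← MemLp.toLp_sub, Lp.norm_toLp]
    refine ENNReal.toReal_le_of_le_ofReal (mul_nonneg hM (growth_nonneg hB a b)) ?_
    rw [ENNReal.ofReal_mul hM]
    refine (eLpNorm_le_mul_eLpNorm_of_ae_le_mul (g := weight N j a b) (c := M) ?_ 2).trans
      (mul_le_mul' le_rfl (hw a b))
    filter_upwards [hae] with x hx
    rw [Real.norm_of_nonneg (weight_nonneg a b x)]
    exact (hpt a b x hx).1
  · simpa using (tendsto_growth hN B a).const_mul M
  · have hηD : eLpNorm (fun x => j b x - j a x) 2 (volume.restrict Ω)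
        ≤ ENNReal.ofReal ‖j b - j a‖ := by
      rw [eLpNorm_coe_sub, ← map_sub, ofReal_norm, Lp.enorm_def]
    obtain ⟨hi, hle⟩ := lintegral_weight_mul_le (η := fun x => j b x - j a x)
      (⟨by rw [ENNReal.inv_two_add_inv_two, inv_one]⟩ : ENNReal.HolderTriple 2 2 1)
      (growth_nonneg hB a b) (hw a b)
      ((aestronglyMeasurable_coe j b).sub (aestronglyMeasurable_coe j a)) hηD
    rw [max_eq_left (norm_nonneg _)] at hle
    have e : inner ℝ ((hmem a).toLp _) (j b - j a)
        = ∫ x in Ω, N.f x (j a x) * (j b x - j a x) := by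
      rw [hinner]
      refine integral_congr_ae ?_
      filter_upwards [Lp.coeFn_sub (j b) (j a)] with x hx
      rw [hx, Pi.sub_apply]
    have hi2 : Integrable (fun x => N.f x (j a x) * (j b x - j a x))
        (volume.restrict Ω) := by
      simp only [mul_sub]
      exact (hint a b).sub (hint a a)
    have hi1 : Integrable (fun x => N.primitive x (j b x) - N.primitive x (j a x))
        (volume.restrict Ω) := (hprim b).sub (hprim a)
    rw [e, ← integral_sub (hprim b) (hprim a), ← integral_sub hi1 hi2]
    have h1 : ‖∫ x in Ω, (N.primitive x (j b x) - N.primitive x (j a x)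
        - N.f x (j a x) * (j b x - j a x))‖ ≤
        ∫ x in Ω, M * (weight N j a b x * |j b x - j a x|) := by
      refine norm_integral_le_of_norm_le (hi.const_mul M) ?_
      filter_upwards [hae] with x hx
      exact (hpt a b x hx).2
    refine h1.trans ?_
    rw [integral_const_mul, mul_assoc]
    exact mul_le_mul_of_nonneg_left hle hM

end

/-! ### The concavity argument for solutions and the conditions on the data. -/

section

section Abstract

variable {H L V : Type*} [NormedAddCommGroup H] [InnerProductSpace ℝ H]
  [NormedAddCommGroup L] [InnerProductSpace ℝ L]
  [NormedAddCommGroup V] [InnerProductSpace ℝ V]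

/-- Write `(v(s), u(s)) = (v(s), u(t)) + (v(s), u(s) - u(t))`. The first term has a fixed test
function, so the weak form differentiates it. In the second the right factor vanishes at `s = t`, so
continuity of `v` suffices. -/
lemma hasDerivWithinAt_inner_velocity {j : H →L[ℝ] L} {D : H →L[ℝ] V} {G : H → H → ℝ}
    (hG : ∀ η, Continuous fun z => G z η) {u : ℝ → H} {v : ℝ → L}
    (hu : ContinuousOn u (Ici 0)) (hv : ContinuousOn v (Ici 0))
    (huv : ∀ t ∈ Ici (0 : ℝ), HasDerivWithinAt (fun s => j (u s)) (v t) (Ici 0) t)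
    (hweak : ∀ η : H, ∀ t ∈ Ici (0 : ℝ),
      inner ℝ (v t) (j η) + ∫ s in (0 : ℝ)..t, inner ℝ (D (u s)) (D η)
        = (∫ s in (0 : ℝ)..t, G (u s) η) + inner ℝ (v 0) (j η))
    {t : ℝ} (ht : t ∈ Ici (0 : ℝ)) :
    HasDerivWithinAt (fun s => inner ℝ (v s) (j (u s)))
      (‖v t‖ ^ 2 - ‖D (u t)‖ ^ 2 + G (u t) (u t)) (Ici 0) t := by
  have hA : HasDerivWithinAt (fun s => inner ℝ (v s) (j (u t)))
      (G (u t) (u t) - inner ℝ (D (u t)) (D (u t))) (Ici 0) t := by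
    have c1 : ContinuousOn (fun s => G (u s) (u t)) (Ici 0) := (hG (u t)).comp_continuousOn hu
    have c2 : ContinuousOn (fun s => (inner ℝ (D (u s)) (D (u t)) : ℝ)) (Ici 0) :=
      (D.continuous.comp_continuousOn hu).inner continuousOn_const
    have h := ((hasDerivWithinAt_integral_Ici c1 ht).sub
      (hasDerivWithinAt_integral_Ici c2 ht)).add_const (inner ℝ (v 0) (j (u t)))
    refine h.congr (fun s hs => ?_) ?_
    · have := hweak (u t) s hs
      simp only [Pi.sub_apply]
      linarith
    · have := hweak (u t) t ht
      simp only [Pi.sub_apply]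
      linarith
  have hB : HasDerivWithinAt (fun s => inner ℝ (v s) (j (u s) - j (u t)))
      (inner ℝ (v t) (v t)) (Ici 0) t := by
    rw [hasDerivWithinAt_iff_tendsto_slope]
    have h1 := hasDerivWithinAt_iff_tendsto_slope.1 (huv t ht)
    have h2 : Tendsto v (𝓝[Ici 0 \ {t}] t) (𝓝 (v t)) := (hv t ht).mono sdiff_subset
    refine (h2.inner h1).congr fun s => ?_
    simp [slope, inner_smul_right]
  refine ((hA.add hB).congr (fun s _ => ?_) ?_).congr_deriv ?_
  · simp [inner_sub_right]
  · simp
  · rw [real_inner_self_eq_norm_sq, real_inner_self_eq_norm_sq]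
    ring

lemma false_of_energy_le {j : H →L[ℝ] L} {D : H →L[ℝ] V} {Φ : H → ℝ} {G : H → H → ℝ}
    {p C e : ℝ} (hp : 1 < p) (hC : 0 < C) (hPoin : ∀ z, C * ‖j z‖ ^ 2 ≤ ‖D z‖ ^ 2)
    (hG : ∀ η, Continuous fun z => G z η) (hΦ : ∀ z, (p + 1) * Φ z ≤ G z z)
    {u : ℝ → H} {v : ℝ → L}
    (hu : ContinuousOn u (Ici 0)) (hv : ContinuousOn v (Ici 0))
    (huv : ∀ t ∈ Ici (0 : ℝ), HasDerivWithinAt (fun s => j (u s)) (v t) (Ici 0) t)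
    (hweak : ∀ η : H, ∀ t ∈ Ici (0 : ℝ),
      inner ℝ (v t) (j η) + ∫ s in (0 : ℝ)..t, inner ℝ (D (u s)) (D η)
        = (∫ s in (0 : ℝ)..t, G (u s) η) + inner ℝ (v 0) (j η))
    (hen : ∀ t ∈ Ici (0 : ℝ), (1 / 2) * (‖v t‖ ^ 2 + ‖D (u t)‖ ^ 2) - Φ (u t) ≤ e)
    (h0 : ‖j (u 0)‖ ≠ 0) (h1 : 0 ≤ inner ℝ (j (u 0)) (v 0))
    (h2 : e < C * (p - 1) / (2 * (p + 1)) * ‖j (u 0)‖ ^ 2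
      + (1 / 2) * (inner ℝ (j (u 0)) (v 0) ^ 2 / ‖j (u 0)‖ ^ 2)) : False := by
  have hpos : 0 < ‖j (u 0)‖ ^ 2 := by positivity
  refine false_of_differential_inequality (ψ := fun t => ‖j (u t)‖ ^ 2)
    (ψ₁ := fun t => 2 * inner ℝ (v t) (j (u t)))
    (ψ₂ := fun t => 2 * (‖v t‖ ^ 2 - ‖D (u t)‖ ^ 2 + G (u t) (u t)))
    (δ := (p + 1) / 2) (α := (p - 1) * C) (β := 2 * (p + 1) * e)
    (by linarith) (mul_pos (by linarith) hC) (fun t ht => ?_)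
    (fun t ht => (hasDerivWithinAt_inner_velocity hG hu hv huv hweak ht).const_mul 2)
    (fun t ht => ?_) hpos ?_ ?_
  · simpa only [real_inner_comm (v t)] using (huv t ht).norm_sq
  · have e1 := hen t ht
    have e2 := hΦ (u t)
    have e3 := hPoin (u t)
    have e4 : inner ℝ (v t) (j (u t)) ^ 2 ≤ ‖v t‖ ^ 2 * ‖j (u t)‖ ^ 2 := by
      rw [← mul_pow]
      exact sq_le_sq' (neg_le_of_abs_le (abs_real_inner_le_norm _ _)) (real_inner_le_norm _ _)
    -- Twice `(p+1)Φ ≤ G`, plus `2(p+1)` times the energy bound, leaves `(p-1)‖D u‖²`, to which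
    -- Poincaré is applied. Multiplication by `ψ` and Cauchy–Schwarz then give the coefficient
    -- `(p+3)/4 = (δ+1)/2` of `ψ'²`.
    have e5 : (p + 3) * ‖v t‖ ^ 2 + (p - 1) * C * ‖j (u t)‖ ^ 2 - 2 * (p + 1) * e
        ≤ 2 * (‖v t‖ ^ 2 - ‖D (u t)‖ ^ 2 + G (u t) (u t)) := by
      have := mul_le_mul_of_nonneg_left e1 (by linarith : 0 ≤ 2 * (p + 1))
      have := mul_le_mul_of_nonneg_left e3 (by linarith : 0 ≤ p - 1)
      linarith
    have e6 := mul_le_mul_of_nonneg_left e5 (sq_nonneg ‖j (u t)‖)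
    have e7 := mul_le_mul_of_nonneg_left e4 (by linarith : 0 ≤ p + 3)
    refine le_trans ?_ e6
    linarith
  · rw [real_inner_comm]
    positivity
  · rw [real_inner_comm (j (u 0)) (v 0)]
    have hp1 : 0 < p + 1 := by linarith
    have := mul_lt_mul_of_pos_left h2 (by linarith : 0 < 2 * (p + 1))
    have e1 : 2 * (p + 1) * (C * (p - 1) / (2 * (p + 1)) * ‖j (u 0)‖ ^ 2
      + (1 / 2) * (inner ℝ (j (u 0)) (v 0) ^ 2 / ‖j (u 0)‖ ^ 2))
      = (p - 1) * C * ‖j (u 0)‖ ^ 2 +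
        (p + 1) / 2 / 2 * ((2 * inner ℝ (j (u 0)) (v 0)) ^ 2 / ‖j (u 0)‖ ^ 2) := by
      field_simp
    linarith

end Abstract

variable {n : ℕ} {Ω : Set (E n)} {N : Nonlinearity n}

lemma energy_eq (hN : N.Admissible Ω) (u : H01 Ω) (v : L2 Ω) :
    energy N u v = (1 / 2) * (‖v‖ ^ 2 + ‖grad u‖ ^ 2) - ∫ x in Ω, N.primitive x (val u x) := by
  unfold energy
  simp only [hN.integral_f]

/-- By contraposition, `I(u₀) < 0` rules out `‖u₀‖ = 0` in the Gazzola–Squassina case. -/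
lemma nehari_nonneg_of_val_eq_zero {z : H01 Ω} (hz : val z = 0) : 0 ≤ nehari N z := by
  have h : ∫ x in Ω, val z x * N.f x (val z x) = 0 := by
    rw [hz]
    refine integral_eq_zero_of_ae ?_
    filter_upwards [Lp.coeFn_zero ℝ 2 (volume.restrict Ω)] with x hx
    rw [hx]
    simp
  unfold nehari
  rw [h, sub_zero]
  positivity

lemma inv_sq_mul_sq_le {c x y : ℝ} (hc : 0 < c) (hx : 0 ≤ x) (h : x ≤ c * y) :
    (c ^ 2)⁻¹ * x ^ 2 ≤ y ^ 2 := by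
  rw [inv_mul_le_iff₀ (by positivity), ← mul_pow]
  exact pow_le_pow_left₀ hx h 2

/-- Completing the square in `m`, with `κ = (p-1)/(p+1) < 1`, leaves a multiple of `1 - Cκ/(1+C)²`,
which is nonnegative because `Cκ ≤ C ≤ (1+C)²`. -/
lemma xu_bound_le {p C s m : ℝ} (hp : 1 < p) (hC : 0 < C) (hs : 0 < s) :
    C * (p - 1) / ((1 + C) * (p + 1)) * m
      ≤ C * (p - 1) / (2 * (p + 1)) * s + (1 / 2) * (m ^ 2 / s) := by
  set κ := (p - 1) / (p + 1) with hκ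
  have hκ0 : 0 < κ := div_pos (by linarith) (by linarith)
  have hκ1 : κ < 1 := (div_lt_one (by linarith)).2 (by linarith)
  have hp1 : p + 1 ≠ 0 := by linarith
  have e1 : C * (p - 1) / ((1 + C) * (p + 1)) * m = C * κ / (1 + C) * m := by
    rw [hκ]; field_simp
  have e2 : C * (p - 1) / (2 * (p + 1)) * s = C * κ / 2 * s := by
    rw [hκ]; field_simp
  rw [e1, e2, ← sub_nonneg]
  have e3 : C * κ / 2 * s + 1 / 2 * (m ^ 2 / s) - C * κ / (1 + C) * m
      = (1 / (2 * s)) * ((m - C * κ / (1 + C) * s) ^ 2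
        + C * κ * s ^ 2 * (1 - C * κ / (1 + C) ^ 2)) := by
    field_simp
    ring
  rw [e3]
  have e4 : 0 ≤ 1 - C * κ / (1 + C) ^ 2 := by
    rw [sub_nonneg, div_le_one (by positivity)]
    nlinarith [mul_pos hC hκ0]
  positivity

/-- The right-hand side is the sum of the Gazzola–Squassina and Straughan bounds; Xu's bound lies
below it by `xu_bound_le`. -/
lemma initial_data_bound (hp : 1 < N.p 0) {C : ℝ} (hC : 0 < C) {u₀ : H01 Ω} {u₁ : L2 Ω}
    (h : CondStraughan N u₀ u₁ ∨ CondGazzolaSquassina C N u₀ u₁ ∨ CondXu C N u₀ u₁) :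
    ‖val u₀‖ ≠ 0 ∧ 0 ≤ inner ℝ (val u₀) u₁ ∧
      energy N u₀ u₁ < C * (N.p 0 - 1) / (2 * (N.p 0 + 1)) * ‖val u₀‖ ^ 2
        + (1 / 2) * (inner ℝ (val u₀) u₁ ^ 2 / ‖val u₀‖ ^ 2) := by
  have hne : 0 < inner ℝ (val u₀) u₁ → ‖val u₀‖ ≠ 0 := by
    intro h1 h2
    rw [norm_eq_zero.1 h2, inner_zero_left] at h1
    exact lt_irrefl _ h1
  have hk : 0 < C * (N.p 0 - 1) / (2 * (N.p 0 + 1)) :=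
    div_pos (mul_pos hC (by linarith)) (by linarith)
  rcases h with ⟨h1, h2⟩ | ⟨h1, h2, h3⟩ | ⟨h1, h2, h3⟩
  · refine ⟨hne h2, h2.le, h1.trans_le (le_add_of_nonneg_left (by positivity))⟩
  · refine ⟨fun h0 => not_le.2 h3 (nehari_nonneg_of_val_eq_zero (norm_eq_zero.1 h0)), h2,
      h1.trans_le (le_add_of_nonneg_right (by positivity))⟩
  · refine ⟨hne h2, h2.le, h1.trans_le ?_⟩
    exact xu_bound_le hp hC (pow_pos ((norm_nonneg _).lt_of_ne' (hne h2)) 2)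

/-- Conservation of the energy when `f(·,u) ∈ L²(Ω)`. -/
lemma energy_conservation {H : Type*} [NormedAddCommGroup H] [InnerProductSpace ℝ H]
    {j : H →L[ℝ] L2 Ω} {D : H →L[ℝ] L2Vec Ω} {Φ : H → ℝ} {Γ : H → L2 Ω} {R : H → H → ℝ}
    (hΓ : Continuous Γ)
    (hΦ : ∀ a b, |Φ b - Φ a - inner ℝ (Γ a) (j b - j a)| ≤ R a b * ‖j b - j a‖)
    (hR : ∀ a, Tendsto (R a) (𝓝 a) (𝓝 0)) {u : ℝ → H} {v : ℝ → L2 Ω}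
    (hu : ContinuousOn u (Ici 0)) (hv : ContinuousOn v (Ici 0))
    (huv : ∀ t ∈ Ici (0 : ℝ), HasDerivWithinAt (fun s => j (u s)) (v t) (Ici 0) t)
    (hweak : ∀ η : H, ∀ t ∈ Ici (0 : ℝ),
      inner ℝ (v t) (j η) + ∫ s in (0 : ℝ)..t, inner ℝ (D (u s)) (D η)
        = (∫ s in (0 : ℝ)..t, inner ℝ (Γ (u s)) (j η)) + inner ℝ (v 0) (j η))
    {t : ℝ} (ht : t ∈ Ici (0 : ℝ)) :
    (1 / 2) * (‖v t‖ ^ 2 + ‖D (u t)‖ ^ 2) - Φ (u t)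
      = (1 / 2) * (‖v 0‖ ^ 2 + ‖D (u 0)‖ ^ 2) - Φ (u 0) := by
  have hg : ContinuousOn (fun s => Γ (u s)) (Ici 0) := hΓ.comp_continuousOn hu
  have k1 := energy_identity hu hv hg huv hweak ht
  have k2 := integral_eq_sub_Ici (x := fun s => Φ (u s))
    (fun s hs => hasDerivWithinAt_comp_curve hΦ hR (hu s hs) (huv s hs)) (hg.inner hv) ht
  linarith

lemma energy_eq_of_subcritical (hn : 1 ≤ n) (hΩ : IsOpen Ω) (hΩb : Bornology.IsBounded Ω)
    (hN : N.Admissible Ω) (hsub : 3 ≤ n → N.pmax < (n : ℝ) / ((n : ℝ) - 2))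
    {u₀ : H01 Ω} {u₁ : L2 Ω} {u : ℝ → H01 Ω} {v : ℝ → L2 Ω}
    (hs : IsGlobalWeakSolution N u₀ u₁ u v) {t : ℝ} (ht : t ∈ Ici (0 : ℝ)) :
    energy N (u t) (v t) = energy N u₀ u₁ := by
  obtain ⟨Γ, R, hΓ, hΓi, hR, hΦ⟩ := exists_potential_gradient (j := val) hN hΩ hΩb
    (exists_sobolev_const_ofReal hn hΩb) hsub
  rw [energy_eq hN, energy_eq hN, ← hs.initial, ← hs.initial_deriv]
  refine energy_conservation (D := grad)
    (Φ := fun z : H01 Ω => ∫ x in Ω, N.primitive x (val z x)) hΓ hΦ hR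
    hs.continuousOn hs.continuousOn_deriv hs.hasDeriv (fun η t ht => ?_) ht
  simp only [hΓi, hs.initial_deriv]
  exact hs.weak η t ht

end

end WaveBlowUp

end

open WaveBlowUp in
theorem proposition3 {n : ℕ} (hn : 1 ≤ n) {Ω : Set (WaveBlowUp.E n)}
    (hΩ : IsOpen Ω) (hΩb : Bornology.IsBounded Ω)
    (N : WaveBlowUp.Nonlinearity n) (hN : N.Admissible Ω)
    (C₂ : ℝ) (hC₂ : 0 < C₂)
    (hP : ∀ z : WaveBlowUp.H01 Ω, ‖WaveBlowUp.val z‖ ≤ C₂ * ‖WaveBlowUp.grad z‖)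
    (u₀ : WaveBlowUp.H01 Ω) (u₁ : WaveBlowUp.L2 Ω)
    (h : WaveBlowUp.CondStraughan N u₀ u₁ ∨
      WaveBlowUp.CondGazzolaSquassina (C₂ ^ 2)⁻¹ N u₀ u₁ ∨
      WaveBlowUp.CondXu (C₂ ^ 2)⁻¹ N u₀ u₁) :
    (0 < WaveBlowUp.energy N u₀ u₁ → WaveBlowUp.CondNew (C₂ ^ 2)⁻¹ N u₀ u₁) ∧
    ¬ ∃ (u : ℝ → WaveBlowUp.H01 Ω) (v : ℝ → WaveBlowUp.L2 Ω),
      WaveBlowUp.IsGlobalWeakSolution N u₀ u₁ u v ∧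
      (3 ≤ n → (n : ℝ) / ((n : ℝ) - 2) ≤ N.p (Fin.last N.r) →
        ∀ t : ℝ, 0 ≤ t → WaveBlowUp.energy N (u t) (v t) ≤ WaveBlowUp.energy N u₀ u₁) := by
  have hC : 0 < (C₂ ^ 2)⁻¹ := by positivity
  obtain ⟨h0, h1, h2⟩ := initial_data_bound hN.one_lt_p hC h
  refine ⟨fun he => ⟨h0, h1, he, h2⟩, ?_⟩
  rintro ⟨u, v, hs, hen⟩
  obtain rfl := hs.initial
  obtain rfl := hs.initial_deriv
  have hS := exists_sobolev_const_ofReal (Ω := Ω) hn hΩb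
  obtain ⟨-, -, hcont, hprim⟩ := exists_dual_bound (j := val) hN hΩ hΩb hS
  have hle : ∀ t ∈ Ici (0 : ℝ), energy N (u t) (v t) ≤ energy N (u 0) (v 0) := by
    -- The energy inequality is assumed exactly in the range where the `L²` argument for
    -- conservation does not apply.
    by_cases hcrit : 3 ≤ n ∧ (n : ℝ) / ((n : ℝ) - 2) ≤ N.p (Fin.last N.r)
    · exact hen hcrit.1 hcrit.2
    · exact fun t ht => (energy_eq_of_subcritical hn hΩ hΩb hN
        (fun h3 => not_le.1 fun h4 => hcrit ⟨h3, h4⟩) hs ht).le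
  refine false_of_energy_le (j := val) (D := grad)
    (Φ := fun z : H01 Ω => ∫ x in Ω, N.primitive x (val z x))
    (G := fun z η : H01 Ω => ∫ x in Ω, N.f x (val z x) * val η x) hN.one_lt_p hC
    (fun z => inv_sq_mul_sq_le hC₂ (norm_nonneg _) (hP z)) hcont hprim
    hs.continuousOn hs.continuousOn_deriv hs.hasDeriv hs.weak
    (fun t ht => (energy_eq hN (u t) (v t)).symm.trans_le (hle t ht)) h0 h1 h2
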